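/- Let $\mathbb H$ be the real quaternions, $\mathbb S=\{I\in\mathbb H: I^2=-1\}$, and for $T\subseteq\mathbb H$, $I\in\mathbb S$ put $T_I=T\cap(\mathbb R+I\mathbb R)$. For an open $\Omega\subseteq\mathbb H$, a function $f:\Omega\to\mathbb H$ is \emph{regular} if for every $I\in\mathbb S$ the function $(x,y)\mapsto f(x+Iy)$ is $C^1$ and $\frac12\left(\frac{\partial}{\partial x}+I\frac{\partial}{\partial y}\right)f(x+Iy)=0$ on $\Omega_I$. A \emph{symmetric slice domain} is an open connected $\Omega\subseteq\mathbb H$ that meets $\mathbb R$, such that every $\Omega_I$ is connected and such that $x+Iy\in\Omega$ ($x,y\in\mathbb R$, $I\in\mathbb S$) implies $x+Jy\in\Omega$ for all $J\in\mathbb S$. If $f,g$ are regular on a symmetric slice domain $\Omega$ and $I,J\in\mathbb S$ are orthogonal, write $f=F+GJ$ and $g=H+KJ$ on $\Omega_I$ with $F,G,H,K$ valued in $\mathbb R+I\mathbb R$. The \emph{$*$-product} $f*g$ is the unique regular function on $\Omega$ that equals $$[F(z)H(z)-G(z)\overline{K(\bar z)}]+[F(z)K(z)+G(z)\overline{H(\bar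 z)}]J$$ on $\Omega_I$; it does not depend on $I,J$. The regular conjugate $f^c$ is the regular function that equals $\overline{F(\bar z)}-G(z)J$ on $\Omega_I$; $f^s=f*f^c$; and if $f\not\equiv0$ then $f^{-*}=(f^s)^{-1}f^c$ off the zeros of $f^s$. For $p\in\mathbb H$ and $n\ge0$, $(q-p)^{*n}$ is the $n$-th $*$-power of $q\mapsto q-p$, and $(q-p)^{*(-n)}$ is its reciprocal $((q-p)^{*n})^{-*}$. For $p,q$ on a common complex line $\mathbb R+I\mathbb R$ let $\sigma(q,p)=\tau(q,p)=|q-p|$; otherwise let $\sigma(q,p)$, respectively $\tau(q,p)$, be $\sqrt{(\mathrm{Re}\,q-\mathrm{Re}\,p)^2+(|\mathrm{Im}\,q|\pm|\mathrm{Im}\,p|)^2}$ with sign $+$, respectively $-$. Put $\Sigma(p,0,R)=\{q:\tau(q,p)>0,\ \sigma(q,p)<R\}$. Let $f$ be regular on a symmetric slice domain $\Omega'$. A point $p$ is a \emph{singularity} of $f$ if $\Sigma(p,0,R)\subseteq\Omega'$ for some $R>0$. A singularity $p$ is a \emph{pole} if, for some such $R$, there are $m\in\mathbb N$ and $a_n\in\mathbb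 H$ with $f(q)=\sum_{n\ge-m}(q-p)^{*n}a_n$ on $\Sigma(p,0,R)$; it is \emph{removable} if $f$ extends to a neighborhood of $p$ as a regular function. Let $\Omega$ be a symmetric slice domain. A function $f$ is \emph{semiregular} in $\Omega$ if it is regular on a symmetric slice domain $\Omega_f\subseteq\Omega$ all of whose missing points $p\in\Omega\setminus\Omega_f$ are poles or removable singularities of $f$. Semiregular functions $f,g$ in $\Omega$ are identified if $f=g$ on $\Omega_f\cap\Omega_g$. \textbf{Proposition.} For every symmetric slice domain $\Omega$, the set of (classes of) semiregular functions in $\Omega$ is a division ring with respect to $+$ and $*$: for semiregular $f,g$ in $\Omega$, the set $\Omega_f\cap\Omega_g$ is a symmetric slice domain, the functions $f+g$ and $f*g$ formed on $\Omega_f\cap\Omega_g$ are again semiregular in $\Omega$, and with these (well-defined) operations the set of semiregular functions in $\Omega$ is a division ring. -/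

import Mathlib

open scoped Quaternion

namespace SliceReg

/-- The 2-sphere of imaginary units `I ^ 2 = -1`. -/
def imagUnits : Set ℍ[ℝ] := {I | I ^ 2 = -1}

/-- The point `x + I y` of the complex line `ℝ + I ℝ`, written with `z = x + i y` in `ℂ`. -/
noncomputable def slicePt (I : ℍ[ℝ]) (z : ℂ) : ℍ[ℝ] := (z.re : ℍ[ℝ]) + I * (z.im : ℍ[ℝ])

/-- The complex line `ℝ + I ℝ`. -/
def sliceLine (I : ℍ[ℝ]) : Set ℍ[ℝ] := Set.range (slicePt I)

/-- `f` is slice regular on the open set `Ω`: for each imaginary unit `I`, the restriction of `f`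
to `Ω ∩ (ℝ + I ℝ)`, seen as a function of `x + i y`, is continuously differentiable and satisfies
`(1/2) (∂/∂x + I ∂/∂y) f (x + I y) = 0`. -/
def SliceRegularOn (f : ℍ[ℝ] → ℍ[ℝ]) (Ω : Set ℍ[ℝ]) : Prop :=
  ∀ I ∈ imagUnits,
    ContDiffOn ℝ 1 (fun z : ℂ => f (slicePt I z)) (slicePt I ⁻¹' Ω) ∧
    ∀ z ∈ slicePt I ⁻¹' Ω,
      (1 / 2 : ℍ[ℝ]) * (fderiv ℝ (fun w : ℂ => f (slicePt I w)) z 1 +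
        I * fderiv ℝ (fun w : ℂ => f (slicePt I w)) z Complex.I) = 0

/-- A slice domain: a domain of `ℍ` that meets the real axis and whose intersection with each
complex line `ℝ + I ℝ` is a domain of that line (openness in the line is automatic). -/
def IsSliceDomain (Ω : Set ℍ[ℝ]) : Prop :=
  IsOpen Ω ∧ IsConnected Ω ∧ (∃ r : ℝ, (r : ℍ[ℝ]) ∈ Ω) ∧
    ∀ I ∈ imagUnits, IsConnected (Ω ∩ sliceLine I)

/-- Axially symmetric sets: with `x + I y` they contain the whole sphere `x + y 𝕊`. -/
def IsAxiallySymmetric (T : Set ℍ[ℝ]) : Prop :=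
  ∀ z : ℂ, ∀ I ∈ imagUnits, slicePt I z ∈ T → ∀ J ∈ imagUnits, slicePt J z ∈ T

/-- Symmetric slice domains. -/
def IsSymmSliceDomain (Ω : Set ℍ[ℝ]) : Prop :=
  IsSliceDomain Ω ∧ IsAxiallySymmetric Ω

/-! ### The regular product, conjugate, symmetrization and reciprocal -/

/-- For orthogonal imaginary units `I`, `J`, each quaternion is uniquely `a + b J` with `a`, `b` in
`ℝ + I ℝ`. This is `a`. -/
noncomputable def splitFst (I q : ℍ[ℝ]) : ℍ[ℝ] := (1 / 2 : ℍ[ℝ]) * (q - I * q * I)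

/-- For orthogonal imaginary units `I`, `J`, each quaternion is uniquely `a + b J` with `a`, `b` in
`ℝ + I ℝ`. This is `b`, the first component of `-(a + b J) J = b - a J`. -/
noncomputable def splitSnd (I J q : ℍ[ℝ]) : ℍ[ℝ] := splitFst I (-(q * J))

/-- The extension `ext φ` to `ℍ` of a function `φ` on the complex line `ℝ + I ℝ`: at
`q = x + K y` with `y = |Im q|` it is
`((1 - K I) / 2) φ (x + I y) + ((1 + K I) / 2) φ (x - I y)`.
At real `q` the formula gives `φ q`. -/
noncomputable def sliceExt (I : ℍ[ℝ]) (φ : ℍ[ℝ] → ℍ[ℝ]) (q : ℍ[ℝ]) : ℍ[ℝ] :=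
  let K : ℍ[ℝ] := ‖q.im‖⁻¹ • q.im
  (1 / 2 : ℍ[ℝ]) * (1 - K * I) * φ (slicePt I ⟨q.re, ‖q.im‖⟩) +
    (1 / 2 : ℍ[ℝ]) * (1 + K * I) * φ (slicePt I ⟨q.re, -‖q.im‖⟩)

/-- With `f = F + G J` and `g = H + K J` on `ℝ + I ℝ`, this is the function
`[F(z) H(z) - G(z) conj (K(conj z))] + [F(z) K(z) + G(z) conj (H(conj z))] J` on `ℝ + I ℝ`. -/
noncomputable def starMulSlice (I J : ℍ[ℝ]) (f g : ℍ[ℝ] → ℍ[ℝ]) (z : ℍ[ℝ]) : ℍ[ℝ] :=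
  let F : ℍ[ℝ] → ℍ[ℝ] := fun w => splitFst I (f w)
  let G : ℍ[ℝ] → ℍ[ℝ] := fun w => splitSnd I J (f w)
  let H : ℍ[ℝ] → ℍ[ℝ] := fun w => splitFst I (g w)
  let K : ℍ[ℝ] → ℍ[ℝ] := fun w => splitSnd I J (g w)
  (F z * H z - G z * star (K (star z))) + (F z * K z + G z * star (H (star z))) * J

/-- The regular product `f * g`, computed with the orthogonal imaginary units `I`, `J`. -/
noncomputable def starMul (I J : ℍ[ℝ]) (f g : ℍ[ℝ] → ℍ[ℝ]) : ℍ[ℝ] → ℍ[ℝ] :=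
  sliceExt I (starMulSlice I J f g)

/-- With `f = F + G J` on `ℝ + I ℝ`, the regular conjugate `f ^ c` is the extension of
`conj (F(conj z)) - G(z) J`. -/
noncomputable def regConj (I J : ℍ[ℝ]) (f : ℍ[ℝ] → ℍ[ℝ]) : ℍ[ℝ] → ℍ[ℝ] :=
  sliceExt I fun z => star (splitFst I (f (star z))) - splitSnd I J (f z) * J

/-- The symmetrization `f ^ s = f * f ^ c`. -/
noncomputable def symmetrization (I J : ℍ[ℝ]) (f : ℍ[ℝ] → ℍ[ℝ]) : ℍ[ℝ] → ℍ[ℝ] :=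
  starMul I J f (regConj I J f)

/-- The regular reciprocal `f ^ (-*) = (1 / f ^ s) f ^ c`, meaningful off the zeros of `f ^ s`. -/
noncomputable def starInv (I J : ℍ[ℝ]) (f : ℍ[ℝ] → ℍ[ℝ]) (q : ℍ[ℝ]) : ℍ[ℝ] :=
  (symmetrization I J f q)⁻¹ * regConj I J f q

/-- The quaternion `i`. -/
noncomputable def unitI : ℍ[ℝ] := ⟨0, 1, 0, 0⟩

/-- The quaternion `j`. -/
noncomputable def unitJ : ℍ[ℝ] := ⟨0, 0, 1, 0⟩

/-- The regular power `q ↦ (q - p) ^ (*n)` for natural `n`, computed with `i`, `j`. -/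
noncomputable def starNatPow (p : ℍ[ℝ]) : ℕ → ℍ[ℝ] → ℍ[ℝ]
  | 0 => fun _ => 1
  | n + 1 => starMul unitI unitJ (starNatPow p n) (fun q => q - p)

/-- The regular power `q ↦ (q - p) ^ (*n)` for integral `n`; for negative `n` it is the regular
reciprocal of `(q - p) ^ (*(-n))`. -/
noncomputable def starPow (p : ℍ[ℝ]) : ℤ → ℍ[ℝ] → ℍ[ℝ]
  | Int.ofNat n => starNatPow p n
  | Int.negSucc n => starInv unitI unitJ (starNatPow p (n + 1))

/-! ### Singularities -/

/-- `p` and `q` lie on the same complex line. -/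
def SameLine (q p : ℍ[ℝ]) : Prop := ∃ I ∈ imagUnits, q ∈ sliceLine I ∧ p ∈ sliceLine I

open Classical in
/-- The distance `σ`. -/
noncomputable def sigmaDist (q p : ℍ[ℝ]) : ℝ :=
  if SameLine q p then ‖q - p‖ else √((q.re - p.re) ^ 2 + (‖q.im‖ + ‖p.im‖) ^ 2)

open Classical in
/-- The function `τ`. -/
noncomputable def tauDist (q p : ℍ[ℝ]) : ℝ :=
  if SameLine q p then ‖q - p‖ else √((q.re - p.re) ^ 2 + (‖q.im‖ - ‖p.im‖) ^ 2)

/-- The set `Σ(p, R₁, R₂)`. -/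
def sigmaShell (p : ℍ[ℝ]) (R₁ R₂ : ℝ) : Set ℍ[ℝ] :=
  {q | R₁ < tauDist q p ∧ sigmaDist q p < R₂}

/-- `p` is a singularity for the functions that are regular on `Ω`. -/
def IsSingularity (Ω : Set ℍ[ℝ]) (p : ℍ[ℝ]) : Prop := ∃ R > 0, sigmaShell p 0 R ⊆ Ω

/-- `p` is a pole (of some order `m ≥ 0`) of the function `f`, regular on `Ω`: `p` is a singularity
and in some `Σ(p, 0, R)` inside `Ω` the Laurent expansion `f q = ∑ (q - p) ^ (*n) aₙ` has
`aₙ = 0` for all `n < -m`. -/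
def IsPole (Ω : Set ℍ[ℝ]) (f : ℍ[ℝ] → ℍ[ℝ]) (p : ℍ[ℝ]) : Prop :=
  ∃ R > 0, sigmaShell p 0 R ⊆ Ω ∧ ∃ a : ℤ → ℍ[ℝ],
    (∀ q ∈ sigmaShell p 0 R, HasSum (fun n : ℤ => starPow p n q * a n) (f q)) ∧
    ∃ m : ℕ, ∀ k : ℕ, m < k → a (-(k : ℤ)) = 0

/-- `p` is a removable singularity of the function `f`, regular on `Ω`: `p` is a singularity and `f`
extends to a neighborhood of `p` as a regular function. -/
def IsRemovable (Ω : Set ℍ[ℝ]) (f : ℍ[ℝ] → ℍ[ℝ]) (p : ℍ[ℝ]) : Prop :=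
  IsSingularity Ω p ∧ ∃ (U : Set ℍ[ℝ]) (g : ℍ[ℝ] → ℍ[ℝ]),
    IsOpen U ∧ p ∈ U ∧ SliceRegularOn g U ∧ Set.EqOn g f (U ∩ Ω)

/-- A function that is semiregular in `Ω`, with its domain `dom` of regularity. The values of `toFun`
outside `dom` play no role. -/
structure SemiregularFun (Ω : Set ℍ[ℝ]) where
  dom : Set ℍ[ℝ]
  toFun : ℍ[ℝ] → ℍ[ℝ]
  dom_subset : dom ⊆ Ω
  symm_dom : IsSymmSliceDomain dom
  regular : SliceRegularOn toFun dom
  pole : ∀ p ∈ Ω \ dom, IsPole dom toFun p ∨ IsRemovable dom toFun p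

theorem slicePt_continuous (I : ℍ[ℝ]) : Continuous (slicePt I) := by
  unfold slicePt
  have h : Continuous (fun r : ℝ => (r : ℍ[ℝ])) := Quaternion.continuous_coe
  exact (h.comp Complex.continuous_re).add
    (continuous_const.mul (h.comp Complex.continuous_im))

theorem unitI_mem : unitI ∈ imagUnits := by
  change unitI ^ 2 = -1
  rw [sq]
  ext
  · simp only [Quaternion.re_mul, Quaternion.re_neg, Quaternion.re_one]
    norm_num [unitI]
  · simp only [Quaternion.imI_mul, Quaternion.imI_neg, Quaternion.imI_one]
    norm_num [unitI]
  · simp only [Quaternion.imJ_mul, Quaternion.imJ_neg, Quaternion.imJ_one]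
    norm_num [unitI]
  · simp only [Quaternion.imK_mul, Quaternion.imK_neg, Quaternion.imK_one]
    norm_num [unitI]

theorem exists_slicePt (q : ℍ[ℝ]) : ∃ I ∈ imagUnits, ∃ z : ℂ, slicePt I z = q := by
  by_cases h : q.im = 0
  · refine ⟨unitI, unitI_mem, ⟨q.re, 0⟩, ?_⟩
    have := Quaternion.re_add_im q
    rw [h, add_zero] at this
    simp only [slicePt, Quaternion.coe_zero, mul_zero, add_zero]
    exact this
  · have hn : ‖q.im‖ ≠ 0 := norm_ne_zero_iff.mpr h
    refine ⟨‖q.im‖⁻¹ • q.im, ?_, ⟨q.re, ‖q.im‖⟩, ?_⟩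
    · have h1 : q.im * q.im = -((‖q.im‖ * ‖q.im‖ : ℝ) : ℍ[ℝ]) := by
        rw [← Quaternion.normSq_eq_norm_mul_self, ← Quaternion.self_mul_star]
        simp
      simp only [imagUnits, Set.mem_ofPred_eq, sq]
      rw [smul_mul_smul_comm, h1, smul_neg, Quaternion.smul_coe, ← mul_inv,
        inv_mul_cancel₀ (mul_ne_zero hn hn), Quaternion.coe_one]
    · simp only [slicePt]
      rw [Quaternion.mul_coe_eq_smul, smul_smul, mul_inv_cancel₀ hn, one_smul]
      exact Quaternion.re_add_im q

theorem slicePt_injective {I : ℍ[ℝ]} (hI : I ∈ imagUnits) : Function.Injective (slicePt I) := by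
  have hI2 : I * I = -1 := by simpa [imagUnits, sq] using hI
  have hre : I.re = 0 := by
    have h0 := congrArg QuaternionAlgebra.re hI2
    have h1 := congrArg QuaternionAlgebra.imI hI2
    have h2 := congrArg QuaternionAlgebra.imJ hI2
    have h3 := congrArg QuaternionAlgebra.imK hI2
    simp at h0 h1 h2 h3
    by_contra hne
    have e1 : I.imI = 0 := by
      have : I.re * I.imI = 0 := by linarith
      exact (mul_eq_zero.mp this).resolve_left hne
    have e2 : I.imJ = 0 := by
      have : I.re * I.imJ = 0 := by linarith
      exact (mul_eq_zero.mp this).resolve_left hne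
    have e3 : I.imK = 0 := by
      have : I.re * I.imK = 0 := by linarith
      exact (mul_eq_zero.mp this).resolve_left hne
    rw [e1, e2, e3] at h0
    nlinarith [sq_nonneg I.re]
  have hI0 : I ≠ 0 := by
    rintro rfl
    simp at hI2
  intro z w h
  simp only [slicePt] at h
  have hr := congrArg QuaternionAlgebra.re h
  simp [hre] at hr
  rw [hr] at h
  have h' := mul_left_cancel₀ hI0 (add_left_cancel h)
  exact Complex.ext hr (Quaternion.coe_injective h')

theorem SemiregularFun.isSingularity {Ω : Set ℍ[ℝ]} (f : SemiregularFun Ω) {p : ℍ[ℝ]}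
    (hp : p ∈ Ω \ f.dom) : IsSingularity f.dom p := by
  rcases f.pole p hp with ⟨R, hR, h, -⟩ | ⟨h, -⟩
  · exact ⟨R, hR, h⟩
  · exact h

/-- Near a point of `Ω`, the complex line through it lies in `f.dom`, up to that point itself. -/
theorem SemiregularFun.eventually_mem_dom {Ω : Set ℍ[ℝ]} (f : SemiregularFun Ω) {I : ℍ[ℝ]}
    (hI : I ∈ imagUnits) {z : ℂ} (hz : slicePt I z ∈ Ω) :
    ∀ᶠ w in nhdsWithin z {z}ᶜ, slicePt I w ∈ f.dom := by
  by_cases hd : slicePt I z ∈ f.dom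
  · exact nhdsWithin_le_nhds
      ((slicePt_continuous I).continuousAt.preimage_mem_nhds (f.symm_dom.1.1.mem_nhds hd))
  · obtain ⟨R, hR, h⟩ := f.isSingularity ⟨hz, hd⟩
    have hb : ∀ᶠ w in nhdsWithin z {z}ᶜ, ‖slicePt I w - slicePt I z‖ < R := by
      refine nhdsWithin_le_nhds ?_
      have hc : ContinuousAt (fun w => ‖slicePt I w - slicePt I z‖) z :=
        ((slicePt_continuous I).sub continuous_const).norm.continuousAt
      exact hc.eventually_lt continuousAt_const (by simpa using hR)
    filter_upwards [hb, self_mem_nhdsWithin] with w hw hwz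
    have hs : SameLine (slicePt I w) (slicePt I z) := ⟨I, hI, ⟨w, rfl⟩, ⟨z, rfl⟩⟩
    refine h ⟨?_, ?_⟩
    · rw [tauDist, if_pos hs, norm_pos_iff, sub_ne_zero]
      exact fun e => hwz (slicePt_injective hI e)
    · rw [sigmaDist, if_pos hs]
      exact hw

theorem SemiregularFun.continuousAt {Ω : Set ℍ[ℝ]} (f : SemiregularFun Ω) {I : ℍ[ℝ]}
    (hI : I ∈ imagUnits) {z : ℂ} (hz : slicePt I z ∈ f.dom) :
    ContinuousAt (fun w : ℂ => f.toFun (slicePt I w)) z :=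
  (f.regular I hI).1.continuousOn.continuousAt
    ((slicePt_continuous I).continuousAt.preimage_mem_nhds (f.symm_dom.1.1.mem_nhds hz))

/-- Semiregular functions are identified when they coincide wherever both are defined. -/
instance semiregularSetoid (Ω : Set ℍ[ℝ]) : Setoid (SemiregularFun Ω) where
  r f g := Set.EqOn f.toFun g.toFun (f.dom ∩ g.dom)
  iseqv :=
    { refl := fun _ _ _ => rfl
      symm := fun h _ hq => (h hq.symm).symm
      trans := by
        intro f g k hfg hgk q hq
        obtain ⟨I, hI, z, rfl⟩ := exists_slicePt q
        have hf := (f.continuousAt hI hq.1).tendsto.mono_left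
          (nhdsWithin_le_nhds (s := {z}ᶜ))
        have hk := (k.continuousAt hI hq.2).tendsto.mono_left
          (nhdsWithin_le_nhds (s := {z}ᶜ))
        have hz := f.dom_subset hq.1
        refine tendsto_nhds_unique_of_eventuallyEq hf hk ?_
        filter_upwards [f.eventually_mem_dom hI hz, g.eventually_mem_dom hI hz,
          k.eventually_mem_dom hI hz] with w h1 h2 h3
        exact (hfg ⟨h1, h2⟩).trans (hgk ⟨h2, h3⟩) }

/-- The set of semiregular functions on `Ω`. -/
def Semiregular (Ω : Set ℍ[ℝ]) : Type := Quotient (semiregularSetoid Ω)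

/-- The element of `Semiregular Ω` represented by `f`. -/
def Semiregular.mk {Ω : Set ℍ[ℝ]} (f : SemiregularFun Ω) : Semiregular Ω :=
  Quotient.mk (semiregularSetoid Ω) f

end SliceReg

open scoped Quaternion

namespace SliceReg

open scoped ComplexConjugate Topology
open Filter

/-! A regular function on a symmetric slice domain is encoded by its stem: a map `F` from a
conjugation-invariant part of `ℂ` to the complexified quaternions `ℍ[ℂ]`, with `F (conj z) =
stemConj (F z)` and `f (x + K y) = stemEval K (F z)` for every imaginary unit `K`. The
representation formula (`SliceRegularOn.hasStem`) says that the stem does not depend on the line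
used to compute it. Regularity becomes holomorphy of the four components
(`SliceRegularOn.stemAnalyticAt`, `sliceRegularOn_of_stem`).

In this language the regular product is the pointwise product of `ℍ[ℂ]`, the regular conjugate is
`star`, and the symmetrization is the complex-valued `normSq`. This makes the product independent of
`I`, `J` and reduces the ring axioms to those of `ℍ[ℂ]`.

On the line of `p` the regular powers of `q - p` are ordinary powers (`starPow_slicePt`), and a
small enough shell `Σ(p, 0, R)` lies in that line, or is a punctured ball when `p` is real. Hence
semiregular functions have meromorphic stems, and conversely a meromorphic stem has only poles
(`isPole_of_stem`). Sums and products of meromorphic stems are meromorphic. The missing points form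
isolated spheres, or isolated points on the real axis, so common domains stay connected on each
slice (`isPreconnected_of_eventually_mem`).

`ℍ[ℂ]` has zero divisors, so inverses need an argument. At real points the stem is a real
quaternion, where `normSq` is positive definite; by the identity theorem, `normSq` of a nonzero stem
cannot vanish identically (`SemiregularFun.eventually_normSq_ne_zero`), and `star F / normSq F` is a
meromorphic inverse. Finally, by the identity theorem again, a class is determined by the germ of
its stem on punctured neighborhoods of a real point, so the classes embed in a ring of germs, and
the image is a subring in which nonzero elements are invertible. -/

/-! ### Imaginary units and the complex lines they span. -/

theorem imagUnits_mul_self {I : ℍ[ℝ]} (hI : I ∈ imagUnits) : I * I = -1 := by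
  simpa [imagUnits, sq] using hI

theorem neg_mem_imagUnits {I : ℍ[ℝ]} (hI : I ∈ imagUnits) : -I ∈ imagUnits := by
  simpa [imagUnits] using hI

theorem imagUnits_re {I : ℍ[ℝ]} (hI : I ∈ imagUnits) : I.re = 0 := by
  have hI2 := imagUnits_mul_self hI
  have h0 := congrArg QuaternionAlgebra.re hI2
  have h1 := congrArg QuaternionAlgebra.imI hI2
  have h2 := congrArg QuaternionAlgebra.imJ hI2
  have h3 := congrArg QuaternionAlgebra.imK hI2
  simp at h0 h1 h2 h3
  by_contra hne
  have e1 : I.imI = 0 := (mul_eq_zero.mp (by linarith : I.re * I.imI = 0)).resolve_left hne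
  have e2 : I.imJ = 0 := (mul_eq_zero.mp (by linarith : I.re * I.imJ = 0)).resolve_left hne
  have e3 : I.imK = 0 := (mul_eq_zero.mp (by linarith : I.re * I.imK = 0)).resolve_left hne
  rw [e1, e2, e3] at h0
  nlinarith [sq_nonneg I.re]

theorem imagUnits_sum_sq {I : ℍ[ℝ]} (hI : I ∈ imagUnits) :
    I.imI ^ 2 + I.imJ ^ 2 + I.imK ^ 2 = 1 := by
  have h0 := congrArg QuaternionAlgebra.re (imagUnits_mul_self hI)
  simp [imagUnits_re hI] at h0
  linarith

theorem imagUnits_norm {I : ℍ[ℝ]} (hI : I ∈ imagUnits) : ‖I‖ = 1 := by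
  have h : ‖I‖ * ‖I‖ = 1 := by
    rw [← norm_mul, imagUnits_mul_self hI, norm_neg, norm_one]
  nlinarith [norm_nonneg I]

theorem star_imagUnits {I : ℍ[ℝ]} (hI : I ∈ imagUnits) : star I = -I := by
  ext <;> simp [imagUnits_re hI]

/-- `z ↦ x + I y` as a homomorphism of algebras. -/
noncomputable def sliceHom {I : ℍ[ℝ]} (hI : I ∈ imagUnits) : ℂ →ₐ[ℝ] ℍ[ℝ] :=
  Complex.lift ⟨I, imagUnits_mul_self hI⟩

theorem sliceHom_apply {I : ℍ[ℝ]} (hI : I ∈ imagUnits) (z : ℂ) : sliceHom hI z = slicePt I z := by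
  simp only [sliceHom, Complex.lift_apply, slicePt, Quaternion.mul_coe_eq_smul]
  rfl

theorem slicePt_mul {I : ℍ[ℝ]} (hI : I ∈ imagUnits) (z w : ℂ) :
    slicePt I (z * w) = slicePt I z * slicePt I w := by
  simp only [← sliceHom_apply hI, map_mul]

theorem slicePt_add (I : ℍ[ℝ]) (z w : ℂ) :
    slicePt I (z + w) = slicePt I z + slicePt I w := by
  simp only [slicePt, Complex.add_re, Complex.add_im, Quaternion.coe_add, mul_add]
  abel

theorem slicePt_sub (I : ℍ[ℝ]) (z w : ℂ) :
    slicePt I (z - w) = slicePt I z - slicePt I w := by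
  simp only [slicePt, Complex.sub_re, Complex.sub_im, Quaternion.coe_sub, mul_sub]
  abel

theorem slicePt_ofReal (I : ℍ[ℝ]) (x : ℝ) : slicePt I (x : ℂ) = (x : ℍ[ℝ]) := by
  simp [slicePt]

theorem slicePt_inv {I : ℍ[ℝ]} (hI : I ∈ imagUnits) (z : ℂ) :
    slicePt I z⁻¹ = (slicePt I z)⁻¹ := by
  simp only [← sliceHom_apply hI, map_inv₀]

theorem slicePt_neg_unit (I : ℍ[ℝ]) (z : ℂ) : slicePt (-I) z = slicePt I (conj z) := by
  simp [slicePt]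

theorem star_slicePt {I : ℍ[ℝ]} (hI : I ∈ imagUnits) (z : ℂ) :
    star (slicePt I z) = slicePt I (conj z) := by
  simp [slicePt, star_imagUnits hI, Quaternion.mul_coe_eq_smul]

theorem slicePt_re {I : ℍ[ℝ]} (hI : I ∈ imagUnits) (z : ℂ) : (slicePt I z).re = z.re := by
  simp [slicePt, Quaternion.mul_coe_eq_smul, imagUnits_re hI]

theorem slicePt_im {I : ℍ[ℝ]} (hI : I ∈ imagUnits) (z : ℂ) :
    (slicePt I z).im = z.im • I := by
  ext <;> simp [slicePt, Quaternion.mul_coe_eq_smul, imagUnits_re hI]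

theorem norm_slicePt_im {I : ℍ[ℝ]} (hI : I ∈ imagUnits) (z : ℂ) :
    ‖(slicePt I z).im‖ = |z.im| := by
  rw [slicePt_im hI, norm_smul, imagUnits_norm hI, mul_one, Real.norm_eq_abs]

theorem norm_slicePt {I : ℍ[ℝ]} (hI : I ∈ imagUnits) (z : ℂ) : ‖slicePt I z‖ = ‖z‖ := by
  have h : ‖slicePt I z‖ * ‖slicePt I z‖ = ‖z‖ * ‖z‖ := by
    rw [← Quaternion.normSq_eq_norm_mul_self, Complex.norm_mul_self_eq_normSq,
      Quaternion.normSq_def', Complex.normSq_apply]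
    simp only [slicePt, Quaternion.mul_coe_eq_smul]
    simp [imagUnits_re hI]
    linear_combination z.im ^ 2 * imagUnits_sum_sq hI
  exact (mul_self_inj (norm_nonneg _) (norm_nonneg _)).mp h

theorem slicePt_isometry {I : ℍ[ℝ]} (hI : I ∈ imagUnits) : Isometry (slicePt I) :=
  Isometry.of_dist_eq fun z w => by
    rw [dist_eq_norm, dist_eq_norm, ← slicePt_sub, norm_slicePt hI]

theorem slicePt_commute {I : ℍ[ℝ]} (hI : I ∈ imagUnits) (z : ℂ) : Commute I (slicePt I z) := by
  have h : I = slicePt I Complex.I := by simp [slicePt]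
  have := (Commute.all Complex.I z).map (sliceHom hI)
  rwa [sliceHom_apply, sliceHom_apply, ← h] at this

/-! ### Complexified quaternions -/

/-- The element `x + ι y` of `ℍ ⊗ ℂ`. -/
noncomputable def stemMk (x y : ℍ[ℝ]) : ℍ[ℂ] :=
  ⟨⟨x.re, y.re⟩, ⟨x.imI, y.imI⟩, ⟨x.imJ, y.imJ⟩, ⟨x.imK, y.imK⟩⟩

/-- The component `x` of `x + ι y`. -/
noncomputable def stemRe (W : ℍ[ℂ]) : ℍ[ℝ] := ⟨W.re.re, W.imI.re, W.imJ.re, W.imK.re⟩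

/-- The component `y` of `x + ι y`. -/
noncomputable def stemIm (W : ℍ[ℂ]) : ℍ[ℝ] := ⟨W.re.im, W.imI.im, W.imJ.im, W.imK.im⟩

/-- The conjugation `x + ι y ↦ x - ι y`. -/
noncomputable def stemConj (W : ℍ[ℂ]) : ℍ[ℂ] := ⟨conj W.re, conj W.imI, conj W.imJ, conj W.imK⟩

/-- The value `x + I y` of `x + ι y` on the complex line of `I`. -/
noncomputable def stemEval (I : ℍ[ℝ]) (W : ℍ[ℂ]) : ℍ[ℝ] := stemRe W + I * stemIm W

theorem stemMk_re (x y : ℍ[ℝ]) : (stemMk x y).re = ⟨x.re, y.re⟩ := rfl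

theorem stemMk_imI (x y : ℍ[ℝ]) : (stemMk x y).imI = ⟨x.imI, y.imI⟩ := rfl

theorem stemMk_imJ (x y : ℍ[ℝ]) : (stemMk x y).imJ = ⟨x.imJ, y.imJ⟩ := rfl

theorem stemMk_imK (x y : ℍ[ℝ]) : (stemMk x y).imK = ⟨x.imK, y.imK⟩ := rfl

@[simp] theorem stemRe_re (W : ℍ[ℂ]) : (stemRe W).re = W.re.re := rfl

@[simp] theorem stemRe_imI (W : ℍ[ℂ]) : (stemRe W).imI = W.imI.re := rfl

@[simp] theorem stemRe_imJ (W : ℍ[ℂ]) : (stemRe W).imJ = W.imJ.re := rfl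

@[simp] theorem stemRe_imK (W : ℍ[ℂ]) : (stemRe W).imK = W.imK.re := rfl

@[simp] theorem stemIm_re (W : ℍ[ℂ]) : (stemIm W).re = W.re.im := rfl

@[simp] theorem stemIm_imI (W : ℍ[ℂ]) : (stemIm W).imI = W.imI.im := rfl

@[simp] theorem stemIm_imJ (W : ℍ[ℂ]) : (stemIm W).imJ = W.imJ.im := rfl

@[simp] theorem stemIm_imK (W : ℍ[ℂ]) : (stemIm W).imK = W.imK.im := rfl

@[simp] theorem stemConj_re (W : ℍ[ℂ]) : (stemConj W).re = conj W.re := rfl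

@[simp] theorem stemConj_imI (W : ℍ[ℂ]) : (stemConj W).imI = conj W.imI := rfl

@[simp] theorem stemConj_imJ (W : ℍ[ℂ]) : (stemConj W).imJ = conj W.imJ := rfl

@[simp] theorem stemConj_imK (W : ℍ[ℂ]) : (stemConj W).imK = conj W.imK := rfl

@[simp] theorem stemRe_stemMk (x y : ℍ[ℝ]) : stemRe (stemMk x y) = x := rfl

@[simp] theorem stemIm_stemMk (x y : ℍ[ℝ]) : stemIm (stemMk x y) = y := rfl

@[simp] theorem stemMk_stemRe_stemIm (W : ℍ[ℂ]) : stemMk (stemRe W) (stemIm W) = W := rfl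

theorem stem_ext {V W : ℍ[ℂ]} (h₁ : stemRe V = stemRe W) (h₂ : stemIm V = stemIm W) : V = W := by
  rw [← stemMk_stemRe_stemIm V, ← stemMk_stemRe_stemIm W, h₁, h₂]

@[simp] theorem stemRe_add (V W : ℍ[ℂ]) : stemRe (V + W) = stemRe V + stemRe W := by
  ext <;> simp

@[simp] theorem stemIm_add (V W : ℍ[ℂ]) : stemIm (V + W) = stemIm V + stemIm W := by
  ext <;> simp

@[simp] theorem stemRe_conj (W : ℍ[ℂ]) : stemRe (stemConj W) = stemRe W := by
  ext <;> simp

@[simp] theorem stemIm_conj (W : ℍ[ℂ]) : stemIm (stemConj W) = -stemIm W := by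
  ext <;> simp

@[simp] theorem stemRe_star (W : ℍ[ℂ]) : stemRe (star W) = star (stemRe W) := by
  ext <;> simp

@[simp] theorem stemIm_star (W : ℍ[ℂ]) : stemIm (star W) = star (stemIm W) := by
  ext <;> simp

@[simp] theorem stemRe_mul (V W : ℍ[ℂ]) :
    stemRe (V * W) = stemRe V * stemRe W - stemIm V * stemIm W := by
  ext <;> simp <;> ring

@[simp] theorem stemIm_mul (V W : ℍ[ℂ]) :
    stemIm (V * W) = stemRe V * stemIm W + stemIm V * stemRe W := by
  ext <;> simp <;> ring

theorem stemConj_add (V W : ℍ[ℂ]) : stemConj (V + W) = stemConj V + stemConj W :=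
  stem_ext (by simp) (by simp; abel)

theorem stemConj_mul (V W : ℍ[ℂ]) : stemConj (V * W) = stemConj V * stemConj W :=
  stem_ext (by simp) (by simp; abel)

theorem stemConj_star (W : ℍ[ℂ]) : stemConj (star W) = star (stemConj W) :=
  stem_ext (by simp) (by simp)

theorem stemConj_stemConj (W : ℍ[ℂ]) : stemConj (stemConj W) = W :=
  stem_ext (by simp) (by simp)

theorem stemConj_coe (c : ℂ) : stemConj (c : ℍ[ℂ]) = ((conj c : ℂ) : ℍ[ℂ]) := by
  ext <;> simp

theorem stemEval_add (I : ℍ[ℝ]) (V W : ℍ[ℂ]) :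
    stemEval I (V + W) = stemEval I V + stemEval I W := by
  simp only [stemEval, stemRe_add, stemIm_add, mul_add]
  abel

theorem stemEval_coe (I : ℍ[ℝ]) (c : ℂ) : stemEval I (c : ℍ[ℂ]) = slicePt I c := by
  have h1 : stemRe (c : ℍ[ℂ]) = (c.re : ℍ[ℝ]) := by ext <;> simp
  have h2 : stemIm (c : ℍ[ℂ]) = (c.im : ℍ[ℝ]) := by ext <;> simp
  rw [stemEval, h1, h2, slicePt]

theorem stemEval_neg_unit (I : ℍ[ℝ]) (W : ℍ[ℂ]) : stemEval (-I) W = stemEval I (stemConj W) := by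
  simp [stemEval]

/-- Evaluation is not multiplicative, because `I` does not commute with the value of `V`. This
twisted formula is the one that the regular product reproduces. -/
theorem stemEval_mul {I : ℍ[ℝ]} (hI : I ∈ imagUnits) (V W : ℍ[ℂ]) :
    stemEval I (V * W) = stemEval I V * stemRe W + I * stemEval I V * stemIm W := by
  have h := imagUnits_mul_self hI
  simp only [stemEval, stemRe_mul, stemIm_mul, mul_add, add_mul, ← mul_assoc, h]
  simp
  abel

theorem stemEval_mul_of_commute {I : ℍ[ℝ]} (hI : I ∈ imagUnits) {V : ℍ[ℂ]}
    (h : Commute I (stemEval I V)) (W : ℍ[ℂ]) :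
    stemEval I (V * W) = stemEval I V * stemEval I W := by
  rw [stemEval_mul hI, h.eq, mul_assoc, ← mul_add]
  rfl

/-- The stem on `ℂ` of a function whose values at `z` and `conj z` on the complex line of `I` are
`a` and `b`. -/
noncomputable def stemOf (I a b : ℍ[ℝ]) : ℍ[ℂ] :=
  stemMk ((1 / 2 : ℝ) • (a + b)) (-((1 / 2 : ℝ) • (I * (a - b))))

theorem stemConj_stemOf (I a b : ℍ[ℝ]) : stemConj (stemOf I a b) = stemOf I b a :=
  stem_ext (by simp [stemOf, add_comm]) (by
    simp only [stemOf, stemIm_conj, stemIm_stemMk]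
    rw [← smul_neg, ← mul_neg, neg_sub])

theorem stemEval_stemOf {I : ℍ[ℝ]} (hI : I ∈ imagUnits) (a b : ℍ[ℝ]) :
    stemEval I (stemOf I a b) = a := by
  simp only [stemEval, stemOf, stemRe_stemMk, stemIm_stemMk]
  rw [mul_neg, mul_smul_comm, ← mul_assoc, imagUnits_mul_self hI, neg_one_mul, smul_neg, neg_neg,
    ← smul_add]
  rw [show a + b + (a - b) = (2 : ℝ) • a by rw [two_smul]; abel, smul_smul]
  norm_num

theorem stemOf_stemEval {I : ℍ[ℝ]} (hI : I ∈ imagUnits) (W : ℍ[ℂ]) :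
    stemOf I (stemEval I W) (stemEval I (stemConj W)) = W := by
  refine stem_ext ?_ ?_
  · simp only [stemOf, stemEval, stemRe_stemMk, stemRe_conj, stemIm_conj]
    rw [show stemRe W + I * stemIm W + (stemRe W + I * -stemIm W) = (2 : ℝ) • stemRe W by
      rw [two_smul, mul_neg]; abel, smul_smul]
    norm_num
  · simp only [stemOf, stemEval, stemIm_stemMk, stemRe_conj, stemIm_conj]
    rw [show stemRe W + I * stemIm W - (stemRe W + I * -stemIm W) = (2 : ℝ) • (I * stemIm W) by
      rw [two_smul, mul_neg]; abel, mul_smul_comm, ← mul_assoc, imagUnits_mul_self hI, smul_smul]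
    norm_num

theorem stemOf_self (I a : ℍ[ℝ]) : stemOf I a a = stemMk a 0 := by
  simp only [stemOf, sub_self, mul_zero, smul_zero, neg_zero]
  rw [← two_smul ℝ a, smul_smul]
  norm_num

theorem half_mul_two_mul (x : ℍ[ℝ]) : (1 / 2 : ℍ[ℝ]) * (2 * x) = x := by
  have h : (2 : ℍ[ℝ]) ≠ 0 := fun h => by
    rw [← one_add_one_eq_two] at h
    have := congrArg QuaternionAlgebra.re h
    rw [Quaternion.re_add, Quaternion.re_one, Quaternion.re_zero] at this
    norm_num at this
  rw [← mul_assoc, one_div, inv_mul_cancel₀ h, one_mul]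

theorem half_mul_eq_smul (x : ℍ[ℝ]) : (1 / 2 : ℍ[ℝ]) * x = (1 / 2 : ℝ) • x := by
  have h : x = 2 * ((1 / 2 : ℝ) • x) := by rw [two_mul, ← add_smul]; norm_num
  conv_lhs => rw [h]
  exact half_mul_two_mul _

/-- On the sphere through `z`, the function `f` has the values `stemEval K W`. -/
def HasStem (f : ℍ[ℝ] → ℍ[ℝ]) (z : ℂ) (W : ℍ[ℂ]) : Prop :=
  ∀ K ∈ imagUnits, f (slicePt K z) = stemEval K W

theorem HasStem.conj {f : ℍ[ℝ] → ℍ[ℝ]} {z : ℂ} {W : ℍ[ℂ]} (h : HasStem f z W) :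
    HasStem f (conj z) (stemConj W) := fun K hK => by
  rw [← slicePt_neg_unit, h _ (neg_mem_imagUnits hK), stemEval_neg_unit]

theorem hasStem_const (c : ℍ[ℝ]) (z : ℂ) : HasStem (fun _ => c) z (stemMk c 0) := fun K _ => by
  simp [stemEval]

theorem hasStem_sub_const (p : ℍ[ℝ]) (z : ℂ) :
    HasStem (fun q => q - p) z ((z : ℍ[ℂ]) - stemMk p 0) := fun K _ => by
  have h : stemEval K ((z : ℍ[ℂ]) - stemMk p 0) + stemEval K (stemMk p 0) = slicePt K z := by
    rw [← stemEval_add, sub_add_cancel, stemEval_coe]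
  rw [← h]
  simp [stemEval]

/-- The extension formula recovers both components of `W` from the values at `z` and `conj z` on the
line of `I`, then evaluates them at `K`. Replacing `(K, z)` by `(-K, conj z)` reduces to `0 ≤ z.im`.
-/
theorem sliceExt_slicePt {I K : ℍ[ℝ]} (hI : I ∈ imagUnits) (hK : K ∈ imagUnits)
    {φ : ℍ[ℝ] → ℍ[ℝ]} {z : ℂ} {W : ℍ[ℂ]} (h₁ : φ (slicePt I z) = stemEval I W)
    (h₂ : φ (slicePt I (conj z)) = stemEval I (stemConj W)) :
    sliceExt I φ (slicePt K z) = stemEval K W := by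
  have hII := imagUnits_mul_self hI
  have hI0 : I ≠ 0 := by
    rintro rfl
    simp at hII
  wlog hz : 0 ≤ z.im generalizing K z W with H
  · have := H (neg_mem_imagUnits hK) (z := conj z) (W := stemConj W) h₂
      (by rwa [Complex.conj_conj, stemConj_stemConj]) (by simp; linarith)
    rwa [slicePt_neg_unit, Complex.conj_conj, stemEval_neg_unit, stemConj_stemConj] at this
  have e₁ : (⟨(slicePt K z).re, ‖(slicePt K z).im‖⟩ : ℂ) = z := by
    rw [slicePt_re hK, norm_slicePt_im hK, abs_of_nonneg hz]
  have e₂ : (⟨(slicePt K z).re, -‖(slicePt K z).im‖⟩ : ℂ) = conj z := by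
    rw [slicePt_re hK, norm_slicePt_im hK, abs_of_nonneg hz]
    rfl
  simp only [sliceExt]
  rw [e₁, e₂, h₁, h₂]
  -- The unit `L` used by `sliceExt` is `K` off the real axis but the default value `0` on it. Only
  -- its product with `stemIm W` matters, and `stemIm W` vanishes at real points.
  have key : ∀ L : ℍ[ℝ], L * stemIm W = K * stemIm W →
      (1 / 2 : ℍ[ℝ]) * (1 - L * I) * stemEval I W +
        (1 / 2 : ℍ[ℝ]) * (1 + L * I) * stemEval I (stemConj W) = stemEval K W := by
    intro L hL
    simp only [stemEval, stemRe_conj, stemIm_conj]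
    rw [← hL]
    have : (1 - L * I) * (stemRe W + I * stemIm W) + (1 + L * I) * (stemRe W + I * -stemIm W) =
        2 * (stemRe W + L * stemIm W) := by
      have e : L * I * (I * stemIm W) = -(L * stemIm W) := by
        rw [mul_assoc, ← mul_assoc I, hII]
        simp
      simp only [sub_mul, add_mul, mul_add, one_mul, mul_neg, e, two_mul]
      abel
    rw [mul_assoc, mul_assoc, ← mul_add, this, half_mul_two_mul]
  apply key
  rcases hz.eq_or_lt with h0 | h0
  · have : stemIm W = 0 := by
      have hc : conj z = z := Complex.conj_eq_iff_im.mpr h0.symm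
      rw [hc, h₁] at h₂
      simp only [stemEval, stemRe_conj, stemIm_conj, add_right_inj, mul_neg] at h₂
      have h3 : I * stemIm W = 0 := by
        have : (2 : ℝ) • (I * stemIm W) = 0 := by
          rw [two_smul]
          nth_rewrite 2 [h₂]
          exact add_neg_cancel _
        exact (smul_eq_zero.mp this).resolve_left two_ne_zero
      exact (mul_eq_zero.mp h3).resolve_left hI0
    rw [this, mul_zero, mul_zero]
  · rw [slicePt_im hK, norm_smul, imagUnits_norm hK, mul_one, Real.norm_eq_abs, abs_of_pos h0,
      smul_smul, inv_mul_cancel₀ h0.ne', one_smul]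

/-! ### The regular product, conjugate and reciprocal in terms of stems. -/

theorem anticommute_of_inner_eq_zero {I J : ℍ[ℝ]} (hI : I ∈ imagUnits) (hJ : J ∈ imagUnits)
    (h : inner ℝ I J = 0) : J * I = -(I * J) := by
  have h0 : I.imI * J.imI + I.imJ * J.imJ + I.imK * J.imK = 0 := by
    rw [Quaternion.inner_def] at h
    simp [imagUnits_re hI, imagUnits_re hJ] at h
    linarith
  ext <;> simp [imagUnits_re hI, imagUnits_re hJ]
  · linear_combination -2 * h0
  all_goals ring

theorem splitFst_eq_slicePt {I : ℍ[ℝ]} (hI : I ∈ imagUnits) (x : ℍ[ℝ]) :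
    splitFst I x = slicePt I ⟨x.re, -(I * x).re⟩ := by
  have h := imagUnits_sum_sq hI
  have e : splitFst I x = (1 / 2 : ℝ) • (x - I * x * I) := by
    rw [splitFst, half_mul_eq_smul]
  rw [e]
  ext <;> simp [slicePt, Quaternion.mul_coe_eq_smul, imagUnits_re hI]
  · linear_combination (1 / 2) * x.re * h
  · linear_combination (-1 / 2) * x.imI * h
  · linear_combination (-1 / 2) * x.imJ * h
  · linear_combination (-1 / 2) * x.imK * h

section Split

variable {I J : ℍ[ℝ]}

theorem star_splitFst_mul (hI : I ∈ imagUnits) (hIJ : J * I = -(I * J)) (x : ℍ[ℝ]) :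
    star (splitFst I x) * J = J * splitFst I x := by
  rw [splitFst_eq_slicePt hI, star_slicePt hI]
  simp only [slicePt, add_mul, mul_add, Complex.conj_re, Complex.conj_im,
    Quaternion.mul_coe_eq_smul, Quaternion.coe_mul_eq_smul, mul_smul_comm, smul_mul_assoc, hIJ]
  simp only [neg_smul, smul_neg]

theorem splitSnd_mul (hJ : J ∈ imagUnits) (hIJ : J * I = -(I * J))
    (x : ℍ[ℝ]) : splitSnd I J x * J = (1 / 2 : ℍ[ℝ]) * (x + I * x * I) := by
  have hJJ := imagUnits_mul_self hJ
  have e : J * (I * J) = I := by rw [← mul_assoc, hIJ, neg_mul, mul_assoc, hJJ]; simp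
  simp only [splitSnd, splitFst, mul_assoc, sub_mul, neg_mul, mul_neg, e, hJJ]
  simp

theorem splitFst_add_splitSnd_mul (hJ : J ∈ imagUnits)
    (hIJ : J * I = -(I * J)) (x : ℍ[ℝ]) : splitFst I x + splitSnd I J x * J = x := by
  rw [splitSnd_mul hJ hIJ, splitFst, ← mul_add,
    show x - I * x * I + (x + I * x * I) = 2 * x by rw [two_mul]; abel, half_mul_two_mul]

/-- Since `J` anticommutes with `I`, moving it past an element of the line of `I` conjugates that
element. This collapses the defining formula of the product to `F(z) g(z) + G(z) J g(conj z)`, with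
`y` and `y'` playing the values of `g` at `z` and `conj z`. -/
theorem split_mul (hI : I ∈ imagUnits) (hJ : J ∈ imagUnits) (hIJ : J * I = -(I * J))
    (x y y' : ℍ[ℝ]) :
    (splitFst I x * splitFst I y - splitSnd I J x * star (splitSnd I J y')) +
      (splitFst I x * splitSnd I J y + splitSnd I J x * star (splitFst I y')) * J =
    splitFst I x * y + splitSnd I J x * J * y' := by
  have hJJ := imagUnits_mul_self hJ
  have e1 := star_splitFst_mul hI hIJ y'
  have e2 : star (splitSnd I J y') = -(J * (splitSnd I J y' * J)) := by
    rw [← mul_assoc, splitSnd, ← star_splitFst_mul hI hIJ, mul_assoc, hJJ]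
    simp
  conv_rhs => rw [← splitFst_add_splitSnd_mul hJ hIJ y,
    ← splitFst_add_splitSnd_mul hJ hIJ y']
  rw [e2, add_mul, mul_assoc (splitSnd I J x), e1]
  simp only [mul_add, mul_neg, mul_assoc]
  abel

theorem starMulSlice_slicePt (hI : I ∈ imagUnits) (hJ : J ∈ imagUnits)
    (hIJ : J * I = -(I * J)) {f g : ℍ[ℝ] → ℍ[ℝ]} {z : ℂ} {V W : ℍ[ℂ]}
    (hf : HasStem f z V) (hg : HasStem g z W) :
    starMulSlice I J f g (slicePt I z) = stemEval I (V * W) := by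
  simp only [starMulSlice]
  rw [split_mul hI hJ hIJ, star_slicePt hI, hf I hI, hg I hI, hg.conj I hI,
    splitSnd_mul hJ hIJ, stemEval_mul hI]
  have hII := imagUnits_mul_self hI
  generalize stemEval I V = v
  have e : I * v * I * (I * stemIm W) = -(I * v * stemIm W) := by
    rw [mul_assoc (I * v), ← mul_assoc I, hII]
    simp
  have : (v - I * v * I) * stemEval I W + (v + I * v * I) * stemEval I (stemConj W) =
      2 * (v * stemRe W + I * v * stemIm W) := by
    simp only [stemEval, stemRe_conj, stemIm_conj, sub_mul, add_mul, mul_add, mul_neg, e, two_mul]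
    abel
  rw [splitFst, mul_assoc (1 / 2), mul_assoc (1 / 2), ← mul_add, this, half_mul_two_mul]

theorem HasStem.starMul (hI : I ∈ imagUnits) (hJ : J ∈ imagUnits)
    (hIJ : J * I = -(I * J)) {f g : ℍ[ℝ] → ℍ[ℝ]} {z : ℂ} {V W : ℍ[ℂ]}
    (hf : HasStem f z V) (hg : HasStem g z W) : HasStem (starMul I J f g) z (V * W) :=
  fun _ hK => sliceExt_slicePt hI hK (starMulSlice_slicePt hI hJ hIJ hf hg) (by
    rw [stemConj_mul]
    exact starMulSlice_slicePt hI hJ hIJ hf.conj hg.conj)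

theorem regConjSlice_slicePt (hI : I ∈ imagUnits) (hJ : J ∈ imagUnits)
    (hIJ : J * I = -(I * J)) {f : ℍ[ℝ] → ℍ[ℝ]} {z : ℂ} {V : ℍ[ℂ]} (hf : HasStem f z V) :
    star (splitFst I (f (star (slicePt I z)))) - splitSnd I J (f (slicePt I z)) * J =
      stemEval I (star V) := by
  have hII := imagUnits_mul_self hI
  have hsI := star_imagUnits hI
  rw [star_slicePt hI, hf I hI, hf.conj I hI, splitSnd_mul hJ hIJ]
  have e1 : ∀ x : ℍ[ℝ], star (splitFst I x) = (1 / 2 : ℍ[ℝ]) * (star x - I * star x * I) := by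
    intro x
    simp only [splitFst, half_mul_eq_smul, Quaternion.star_smul, star_sub, star_mul,
      hsI, neg_mul, mul_neg, neg_neg, mul_assoc]
  rw [e1, ← mul_sub]
  simp only [stemEval, stemRe_conj, stemIm_conj, stemRe_star, stemIm_star, star_add, star_mul,
    star_neg, hsI]
  obtain ⟨a, ha⟩ : ∃ a, stemRe V = a := ⟨_, rfl⟩
  obtain ⟨b, hb⟩ : ∃ b, stemIm V = b := ⟨_, rfl⟩
  -- Writing `a = 2 Re a - star a` leaves a central real number and `star a`, so only `I * I = -1`
  -- is needed afterwards.
  have hra : a = (2 * a.re : ℝ) - star a := by ext <;> simp; ring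
  have hrb : b = (2 * b.re : ℝ) - star b := by ext <;> simp; ring
  rw [ha, hb]
  generalize hA : star a = A at *
  generalize hB : star b = B at *
  generalize 2 * a.re = s at hra
  generalize 2 * b.re = t at hrb
  have r1 : ∀ (x : ℝ) , I * (x : ℍ[ℝ]) * I = -(x : ℍ[ℝ]) := fun x => by
    rw [← Quaternion.coe_commutes, mul_assoc, hII]; simp
  have r2 : I * (I * (t : ℍ[ℝ])) * I = -(I * t) := by
    rw [mul_assoc I, r1]; simp
  have r3 : I * (I * B) * I = - (B * I) := by rw [← mul_assoc, hII]; simp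
  have r4 : I * (B * I) * I = - (I * B) := by rw [mul_assoc, mul_assoc, hII]; simp
  subst hra hrb
  simp only [mul_sub, mul_add, sub_mul, add_mul, mul_neg, neg_mul, neg_neg, r1, r2, r3, r4]
  simp only [half_mul_eq_smul]
  module

theorem HasStem.regConj (hI : I ∈ imagUnits) (hJ : J ∈ imagUnits)
    (hIJ : J * I = -(I * J)) {f : ℍ[ℝ] → ℍ[ℝ]} {z : ℂ} {V : ℍ[ℂ]} (hf : HasStem f z V) :
    HasStem (regConj I J f) z (star V) :=
  fun _ hK => sliceExt_slicePt hI hK (regConjSlice_slicePt hI hJ hIJ hf) (by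
    rw [stemConj_star]
    exact regConjSlice_slicePt hI hJ hIJ hf.conj)

/-- The symmetrization has the scalar stem `V * star V = normSq V`. Its value lies on the line of
`K`, so it commutes with `K` and evaluation is multiplicative here. No nonvanishing is required, as
both sides use `0⁻¹ = 0`. -/
theorem HasStem.starInv (hI : I ∈ imagUnits) (hJ : J ∈ imagUnits)
    (hIJ : J * I = -(I * J)) {f : ℍ[ℝ] → ℍ[ℝ]} {z : ℂ} {V : ℍ[ℂ]} (hf : HasStem f z V) :
    HasStem (starInv I J f) z (((Quaternion.normSq V)⁻¹ : ℂ) * star V) := fun K hK => by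
  have h : HasStem (symmetrization I J f) z (V * star V) :=
    hf.starMul hI hJ hIJ (hf.regConj hI hJ hIJ)
  have hc : Commute K (stemEval K (((Quaternion.normSq V)⁻¹ : ℂ) : ℍ[ℂ])) := by
    rw [stemEval_coe]
    exact slicePt_commute hK _
  rw [stemEval_mul_of_commute hK hc, stemEval_coe, slicePt_inv hK, SliceReg.starInv,
    h K hK, hf.regConj hI hJ hIJ K hK, Quaternion.self_mul_star, stemEval_coe]

end Split

/-! ### Regular powers of `q - p` on the complex line of `p`. -/

theorem unitJ_mem : unitJ ∈ imagUnits := by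
  change unitJ ^ 2 = -1
  rw [sq]
  ext
  · simp only [Quaternion.re_mul, Quaternion.re_neg, Quaternion.re_one]
    norm_num [unitJ]
  · simp only [Quaternion.imI_mul, Quaternion.imI_neg, Quaternion.imI_one]
    norm_num [unitJ]
  · simp only [Quaternion.imJ_mul, Quaternion.imJ_neg, Quaternion.imJ_one]
    norm_num [unitJ]
  · simp only [Quaternion.imK_mul, Quaternion.imK_neg, Quaternion.imK_one]
    norm_num [unitJ]

theorem unitJ_mul_unitI : unitJ * unitI = -(unitI * unitJ) :=
  anticommute_of_inner_eq_zero unitI_mem unitJ_mem (by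
    rw [Quaternion.inner_def]
    simp only [Quaternion.re_mul, Quaternion.re_star, Quaternion.imI_star, Quaternion.imJ_star,
      Quaternion.imK_star]
    norm_num [unitI, unitJ])

theorem hasStem_starNatPow (p : ℍ[ℝ]) (z : ℂ) (n : ℕ) :
    HasStem (starNatPow p n) z (((z : ℍ[ℂ]) - stemMk p 0) ^ n) := by
  induction n with
  | zero => exact fun K _ => by simp [starNatPow, stemEval_coe, ← Quaternion.coe_one, slicePt]
  | succ n ih =>
    rw [pow_succ]
    exact ih.starMul unitI_mem unitJ_mem unitJ_mul_unitI (hasStem_sub_const p z)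

theorem stemEval_sub_pow {K : ℍ[ℝ]} (hK : K ∈ imagUnits) (w z : ℂ) (n : ℕ) :
    stemEval K (((z : ℍ[ℂ]) - stemMk (slicePt K w) 0) ^ n) = slicePt K ((z - w) ^ n) := by
  induction n with
  | zero => rw [pow_zero, pow_zero, ← Quaternion.coe_one, stemEval_coe]
  | succ n ih =>
    rw [pow_succ, stemEval_mul_of_commute hK (by rw [ih]; exact slicePt_commute hK _), ih, pow_succ,
      slicePt_mul hK, slicePt_sub, ← hasStem_sub_const _ _ K hK]

theorem starNatPow_slicePt {K : ℍ[ℝ]} (hK : K ∈ imagUnits) (w z : ℂ) (n : ℕ) :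
    starNatPow (slicePt K w) n (slicePt K z) = slicePt K ((z - w) ^ n) := by
  rw [hasStem_starNatPow _ _ _ K hK, stemEval_sub_pow hK]

theorem normSq_sub_stemMk {K : ℍ[ℝ]} (hK : K ∈ imagUnits) (w z : ℂ) :
    Quaternion.normSq ((z : ℍ[ℂ]) - stemMk (slicePt K w) 0) = (z - w) * (z - conj w) := by
  have h := congrArg (fun x : ℝ => (x : ℂ)) (imagUnits_sum_sq hK)
  have hw : w = w.re + w.im * Complex.I := (Complex.re_add_im w).symm
  have hw' : conj w = w.re - w.im * Complex.I := by
    apply Complex.ext <;> simp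
  push_cast at h
  rw [Quaternion.normSq_def', hw']
  conv_rhs => rw [hw]
  simp only [slicePt, Quaternion.mul_coe_eq_smul, Quaternion.re_sub, Quaternion.imI_sub,
    Quaternion.imJ_sub, Quaternion.imK_sub, stemMk_re, stemMk_imI, stemMk_imJ, stemMk_imK]
  simp [imagUnits_re hK, Complex.mk_eq_add_mul_I]
  linear_combination w.im ^ 2 * h + w.im ^ 2 * Complex.I_sq +
    (z - w.re + w.im * Complex.I) * hw

/-- For a negative exponent the numerator contributes a power of `z - conj w`, which cancels one
factor of `normSq = (z - w) (z - conj w)`. The point `z = conj w` is excluded because the reciprocal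
takes its default value there. -/
theorem starPow_slicePt {K : ℍ[ℝ]} (hK : K ∈ imagUnits) {w z : ℂ} (hz : z ≠ conj w)
    (n : ℤ) : starPow (slicePt K w) n (slicePt K z) = slicePt K ((z - w) ^ n) := by
  cases n with
  | ofNat n => exact starNatPow_slicePt hK w z n
  | negSucc n =>
    have h := (hasStem_starNatPow (slicePt K w) z (n + 1)).starInv unitI_mem unitJ_mem
      unitJ_mul_unitI K hK
    have e : star ((z : ℍ[ℂ]) - stemMk (slicePt K w) 0) =
        (z : ℍ[ℂ]) - stemMk (slicePt K (conj w)) 0 := by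
      rw [star_sub, Quaternion.star_coe, ← star_slicePt hK]
      congr 1
      exact stem_ext (by simp) (by simp)
    have hne : z - conj w ≠ 0 := sub_ne_zero.mpr hz
    have e' : star (((z : ℍ[ℂ]) - stemMk (slicePt K w) 0) ^ (n + 1)) =
        ((z : ℍ[ℂ]) - stemMk (slicePt K (conj w)) 0) ^ (n + 1) := by
      rw [← e]
      exact star_pow _ _
    rw [starPow, h, stemEval_mul_of_commute hK (by rw [stemEval_coe]; exact slicePt_commute hK _),
      stemEval_coe, map_pow, normSq_sub_stemMk hK, e', stemEval_sub_pow hK,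
      ← slicePt_mul hK, zpow_negSucc]
    congr 1
    rw [mul_pow, mul_inv, mul_assoc, inv_mul_cancel₀ (pow_ne_zero _ hne), mul_one]

/-- At a real point the powers of `q - p` with `p` real are the pointwise ones on each line. -/
theorem starPow_ofReal {K : ℍ[ℝ]} (hK : K ∈ imagUnits) {x : ℝ} {z : ℂ} (hz : z ≠ x) (n : ℤ) :
    starPow x n (slicePt K z) = slicePt K ((z - x) ^ n) := by
  rw [← slicePt_ofReal K, starPow_slicePt hK (by rwa [Complex.conj_ofReal])]

/-! ### Analytic and meromorphic stems -/

/-- The four components of `F` are analytic at `z`. -/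
def StemAnalyticAt (F : ℂ → ℍ[ℂ]) (z : ℂ) : Prop :=
  AnalyticAt ℂ (fun w => (F w).re) z ∧ AnalyticAt ℂ (fun w => (F w).imI) z ∧
    AnalyticAt ℂ (fun w => (F w).imJ) z ∧ AnalyticAt ℂ (fun w => (F w).imK) z

/-- The four components of `F` are meromorphic at `z`. -/
def StemMeromorphicAt (F : ℂ → ℍ[ℂ]) (z : ℂ) : Prop :=
  MeromorphicAt (fun w => (F w).re) z ∧ MeromorphicAt (fun w => (F w).imI) z ∧
    MeromorphicAt (fun w => (F w).imJ) z ∧ MeromorphicAt (fun w => (F w).imK) z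

section Stems

variable {F G : ℂ → ℍ[ℂ]} {z : ℂ}

theorem StemAnalyticAt.meromorphicAt (h : StemAnalyticAt F z) : StemMeromorphicAt F z :=
  ⟨h.1.meromorphicAt, h.2.1.meromorphicAt, h.2.2.1.meromorphicAt, h.2.2.2.meromorphicAt⟩

theorem StemAnalyticAt.add (hF : StemAnalyticAt F z) (hG : StemAnalyticAt G z) :
    StemAnalyticAt (fun w => F w + G w) z := by
  obtain ⟨f₀, f₁, f₂, f₃⟩ := hF
  obtain ⟨g₀, g₁, g₂, g₃⟩ := hG
  refine ⟨?_, ?_, ?_, ?_⟩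
  · simp only [Quaternion.re_add]; fun_prop
  · simp only [Quaternion.imI_add]; fun_prop
  · simp only [Quaternion.imJ_add]; fun_prop
  · simp only [Quaternion.imK_add]; fun_prop

theorem StemAnalyticAt.mul (hF : StemAnalyticAt F z) (hG : StemAnalyticAt G z) :
    StemAnalyticAt (fun w => F w * G w) z := by
  obtain ⟨f₀, f₁, f₂, f₃⟩ := hF
  obtain ⟨g₀, g₁, g₂, g₃⟩ := hG
  refine ⟨?_, ?_, ?_, ?_⟩
  · simp only [Quaternion.re_mul]; fun_prop
  · simp only [Quaternion.imI_mul]; fun_prop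
  · simp only [Quaternion.imJ_mul]; fun_prop
  · simp only [Quaternion.imK_mul]; fun_prop

theorem StemAnalyticAt.star (hF : StemAnalyticAt F z) : StemAnalyticAt (fun w => star (F w)) z := by
  obtain ⟨f₀, f₁, f₂, f₃⟩ := hF
  refine ⟨?_, ?_, ?_, ?_⟩
  · simp only [Quaternion.re_star]; fun_prop
  · simp only [Quaternion.imI_star]; fun_prop
  · simp only [Quaternion.imJ_star]; fun_prop
  · simp only [Quaternion.imK_star]; fun_prop

theorem StemAnalyticAt.normSq (hF : StemAnalyticAt F z) :
    AnalyticAt ℂ (fun w => Quaternion.normSq (F w)) z := by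
  obtain ⟨f₀, f₁, f₂, f₃⟩ := hF
  simp only [Quaternion.normSq_def']
  fun_prop

theorem stemAnalyticAt_coe {g : ℂ → ℂ} (hg : AnalyticAt ℂ g z) :
    StemAnalyticAt (fun w => (g w : ℍ[ℂ])) z := by
  refine ⟨?_, ?_, ?_, ?_⟩
  · simpa only [Quaternion.re_coe] using hg
  · simpa only [Quaternion.imI_coe] using analyticAt_const
  · simpa only [Quaternion.imJ_coe] using analyticAt_const
  · simpa only [Quaternion.imK_coe] using analyticAt_const

theorem StemMeromorphicAt.add (hF : StemMeromorphicAt F z) (hG : StemMeromorphicAt G z) :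
    StemMeromorphicAt (fun w => F w + G w) z := by
  obtain ⟨f₀, f₁, f₂, f₃⟩ := hF
  obtain ⟨g₀, g₁, g₂, g₃⟩ := hG
  refine ⟨?_, ?_, ?_, ?_⟩
  · simp only [Quaternion.re_add]; fun_prop
  · simp only [Quaternion.imI_add]; fun_prop
  · simp only [Quaternion.imJ_add]; fun_prop
  · simp only [Quaternion.imK_add]; fun_prop

theorem StemMeromorphicAt.mul (hF : StemMeromorphicAt F z) (hG : StemMeromorphicAt G z) :
    StemMeromorphicAt (fun w => F w * G w) z := by
  obtain ⟨f₀, f₁, f₂, f₃⟩ := hF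
  obtain ⟨g₀, g₁, g₂, g₃⟩ := hG
  refine ⟨?_, ?_, ?_, ?_⟩
  · simp only [Quaternion.re_mul]; fun_prop
  · simp only [Quaternion.imI_mul]; fun_prop
  · simp only [Quaternion.imJ_mul]; fun_prop
  · simp only [Quaternion.imK_mul]; fun_prop

theorem StemMeromorphicAt.star (hF : StemMeromorphicAt F z) :
    StemMeromorphicAt (fun w => star (F w)) z := by
  obtain ⟨f₀, f₁, f₂, f₃⟩ := hF
  refine ⟨?_, ?_, ?_, ?_⟩
  · simp only [Quaternion.re_star]; fun_prop
  · simp only [Quaternion.imI_star]; fun_prop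
  · simp only [Quaternion.imJ_star]; fun_prop
  · simp only [Quaternion.imK_star]; fun_prop

theorem StemMeromorphicAt.normSq (hF : StemMeromorphicAt F z) :
    MeromorphicAt (fun w => Quaternion.normSq (F w)) z := by
  obtain ⟨f₀, f₁, f₂, f₃⟩ := hF
  simp only [Quaternion.normSq_def']
  fun_prop

theorem stemMeromorphicAt_coe {g : ℂ → ℂ} (hg : MeromorphicAt g z) :
    StemMeromorphicAt (fun w => (g w : ℍ[ℂ])) z := by
  refine ⟨?_, ?_, ?_, ?_⟩
  · simpa only [Quaternion.re_coe] using hg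
  · simpa only [Quaternion.imI_coe] using MeromorphicAt.const _ _
  · simpa only [Quaternion.imJ_coe] using MeromorphicAt.const _ _
  · simpa only [Quaternion.imK_coe] using MeromorphicAt.const _ _

theorem analyticAt_conj_conj {g : ℂ → ℂ} (hg : AnalyticAt ℂ g (conj z)) :
    AnalyticAt ℂ (fun w => conj (g (conj w))) z := by
  rw [Complex.analyticAt_iff_eventually_differentiableAt] at hg ⊢
  have hc : Tendsto (conj : ℂ → ℂ) (𝓝 z) (𝓝 (conj z)) := Complex.continuous_conj.tendsto z
  filter_upwards [hc.eventually hg] with w hw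
  have h := hw.star_star
  have e : star (conj w) = w := Complex.conj_conj w
  rw [e] at h
  exact h

theorem meromorphicAt_conj_conj {g : ℂ → ℂ} (hg : MeromorphicAt g (conj z)) :
    MeromorphicAt (fun w => conj (g (conj w))) z := by
  obtain ⟨n, hn⟩ := hg
  refine ⟨n, ?_⟩
  have := analyticAt_conj_conj hn
  simpa using this

theorem StemAnalyticAt.conj_conj (hF : StemAnalyticAt F (conj z)) :
    StemAnalyticAt (fun w => stemConj (F (conj w))) z :=
  ⟨analyticAt_conj_conj hF.1, analyticAt_conj_conj hF.2.1, analyticAt_conj_conj hF.2.2.1,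
    analyticAt_conj_conj hF.2.2.2⟩

theorem StemMeromorphicAt.conj_conj (hF : StemMeromorphicAt F (conj z)) :
    StemMeromorphicAt (fun w => stemConj (F (conj w))) z :=
  ⟨meromorphicAt_conj_conj hF.1, meromorphicAt_conj_conj hF.2.1, meromorphicAt_conj_conj hF.2.2.1,
    meromorphicAt_conj_conj hF.2.2.2⟩

/-- The identity theorem for analytic stems. -/
theorem stem_eqOn_of_frequently_eq {D : Set ℂ} (hF : ∀ w ∈ D, StemAnalyticAt F w)
    (hG : ∀ w ∈ D, StemAnalyticAt G w) (hD : IsPreconnected D) (hz : z ∈ D)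
    (h : ∃ᶠ w in 𝓝[≠] z, F w = G w) : Set.EqOn F G D := by
  intro w hw
  have key : ∀ c : ℍ[ℂ] → ℂ, (∀ w ∈ D, AnalyticAt ℂ (fun w => c (F w)) w) →
      (∀ w ∈ D, AnalyticAt ℂ (fun w => c (G w)) w) → c (F w) = c (G w) := fun c h₁ h₂ =>
    AnalyticOnNhd.eqOn_of_preconnected_of_frequently_eq h₁ h₂ hD hz
      (h.mono fun _ e => congrArg c e) hw
  apply Quaternion.ext
  · exact key _ (fun w hw => (hF w hw).1) (fun w hw => (hG w hw).1)
  · exact key _ (fun w hw => (hF w hw).2.1) (fun w hw => (hG w hw).2.1)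
  · exact key _ (fun w hw => (hF w hw).2.2.1) (fun w hw => (hG w hw).2.2.1)
  · exact key _ (fun w hw => (hF w hw).2.2.2) (fun w hw => (hG w hw).2.2.2)

end Stems

/-! ### The stem of a regular function -/

/-- A real-linear functional `ℍ → ℂ` that is complex linear for left multiplication by `K`. -/
def IsSliceLinear (K : ℍ[ℝ]) (l : ℍ[ℝ] →L[ℝ] ℂ) : Prop := ∀ q, l (K * q) = Complex.I * l q

theorem IsSliceLinear.slicePt_mul {K : ℍ[ℝ]} {l : ℍ[ℝ] →L[ℝ] ℂ} (hl : IsSliceLinear K l)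
    (c : ℂ) (q : ℍ[ℝ]) : l (slicePt K c * q) = c * l q := by
  rw [slicePt, Quaternion.mul_coe_eq_smul, add_mul, map_add, Quaternion.coe_mul_eq_smul,
    smul_mul_assoc, map_smul, map_smul, hl q]
  conv_rhs => rw [← Complex.re_add_im c]
  simp only [Complex.real_smul]
  ring

theorem stemRe_smul (r : ℝ) (W : ℍ[ℂ]) : stemRe ((r : ℂ) • W) = r • stemRe W := by
  ext <;> simp

theorem stemIm_smul (r : ℝ) (W : ℍ[ℂ]) : stemIm ((r : ℂ) • W) = r • stemIm W := by
  ext <;> simp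

/-- The component `c` of the stem of a function with value `q` on the line of `K` and value `0`
at the conjugate point. -/
noncomputable def stemFunctional (K : ℍ[ℝ]) (c : ℍ[ℂ] →ₗ[ℂ] ℂ) : ℍ[ℝ] →L[ℝ] ℂ :=
  LinearMap.toContinuousLinearMap
    { toFun := fun q => c (stemOf K q 0)
      map_add' := fun x y => by
        rw [← map_add]
        congr 1
        refine stem_ext ?_ ?_
        · simp only [stemOf, stemRe_stemMk, stemRe_add]
          module
        · simp only [stemOf, stemIm_stemMk, stemIm_add, sub_zero, mul_add]
          module
      map_smul' := fun r x => by
        have : stemOf K (r • x) 0 = (r : ℂ) • stemOf K x 0 := by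
          refine stem_ext ?_ ?_
          · simp only [stemOf, stemRe_stemMk, stemRe_smul]
            module
          · simp only [stemOf, stemIm_stemMk, stemIm_smul, sub_zero, mul_smul_comm]
            module
        simp [this] }

theorem isSliceLinear_stemFunctional {K : ℍ[ℝ]} (hK : K ∈ imagUnits) (c : ℍ[ℂ] →ₗ[ℂ] ℂ) :
    IsSliceLinear K (stemFunctional K c) := fun q => by
  change c _ = Complex.I • c _
  rw [← map_smul]
  congr 1
  have hKK := imagUnits_mul_self hK
  have h1 : ∀ W : ℍ[ℂ], stemRe (Complex.I • W) = -stemIm W := fun W => by ext <;> simp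
  have h2 : ∀ W : ℍ[ℂ], stemIm (Complex.I • W) = stemRe W := fun W => by ext <;> simp
  refine stem_ext ?_ ?_
  · rw [h1]
    simp [stemOf]
  · rw [h2]
    simp [stemOf, ← mul_assoc, hKK]

/-- A slice-linear functional turns left multiplication by `K` into multiplication by `i`, hence the
regularity equation into the Cauchy–Riemann equation. -/
theorem SliceRegularOn.analyticAt {f : ℍ[ℝ] → ℍ[ℝ]} {Ω : Set ℍ[ℝ]} (hf : SliceRegularOn f Ω)
    (hΩ : IsOpen Ω) {K : ℍ[ℝ]} (hK : K ∈ imagUnits) {l : ℍ[ℝ] →L[ℝ] ℂ} (hl : IsSliceLinear K l)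
    {z : ℂ} (hz : slicePt K z ∈ Ω) : AnalyticAt ℂ (fun w => l (f (slicePt K w))) z := by
  have ho : IsOpen (slicePt K ⁻¹' Ω) := hΩ.preimage (slicePt_continuous K)
  refine DifferentiableOn.analyticAt (s := slicePt K ⁻¹' Ω) (fun w hw => ?_) (ho.mem_nhds hz)
  apply DifferentiableAt.differentiableWithinAt
  have hd : DifferentiableAt ℝ (fun w : ℂ => f (slicePt K w)) w :=
    ((hf K hK).1.differentiableOn one_ne_zero).differentiableAt (ho.mem_nhds hw)
  have hc := l.hasFDerivAt.comp w hd.hasFDerivAt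
  have hcr := (hf K hK).2 w hw
  rw [differentiableAt_complex_iff_differentiableAt_real]
  refine ⟨hc.differentiableAt, ?_⟩
  have e : fderiv ℝ (fun w => l (f (slicePt K w))) w = _ := hc.fderiv
  rw [e]
  rw [half_mul_eq_smul, smul_eq_zero_iff_right (by norm_num)] at hcr
  have h2 := congrArg l hcr
  rw [map_add, hl, map_zero] at h2
  simp only [ContinuousLinearMap.comp_apply, smul_eq_mul]
  linear_combination (-Complex.I) * h2 + l (fderiv ℝ (fun w : ℂ => f (slicePt K w)) w Complex.I) *
    Complex.I_sq

/-- The stem of `f`, computed on the complex line of `K`. -/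
noncomputable def stem (K : ℍ[ℝ]) (f : ℍ[ℝ] → ℍ[ℝ]) (z : ℂ) : ℍ[ℂ] :=
  stemOf K (f (slicePt K z)) (f (slicePt K (conj z)))

theorem stemConj_stem (K : ℍ[ℝ]) (f : ℍ[ℝ] → ℍ[ℝ]) (z : ℂ) :
    stemConj (stem K f z) = stem K f (conj z) := by
  rw [stem, stemConj_stemOf, stem, Complex.conj_conj]

/-- Each value of `f` enters separately: the first summand is holomorphic where `f` is regular on
the line, the second is a holomorphic function conjugated on both sides. -/
theorem stem_eq_add (K : ℍ[ℝ]) (f : ℍ[ℝ] → ℍ[ℝ]) (z : ℂ) :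
    stem K f z = stemOf K (f (slicePt K z)) 0 + stemConj (stemOf K (f (slicePt K (conj z))) 0) := by
  rw [stem, stemConj_stemOf]
  refine stem_ext ?_ ?_
  · simp only [stemOf, stemRe_stemMk, stemRe_add]
    module
  · simp only [stemOf, stemIm_stemMk, stemIm_add, mul_sub, mul_zero]
    module

theorem stemEval_stem {K : ℍ[ℝ]} (hK : K ∈ imagUnits) (f : ℍ[ℝ] → ℍ[ℝ]) (z : ℂ) :
    stemEval K (stem K f z) = f (slicePt K z) := stemEval_stemOf hK _ _

theorem stem_ofReal (K : ℍ[ℝ]) (f : ℍ[ℝ] → ℍ[ℝ]) (x : ℝ) : stem K f x = stemMk (f x) 0 := by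
  rw [stem, Complex.conj_ofReal, slicePt_ofReal, stemOf_self]

theorem HasStem.stem_eq {f : ℍ[ℝ] → ℍ[ℝ]} {z : ℂ} {W : ℍ[ℂ]} (h : HasStem f z W) {K : ℍ[ℝ]}
    (hK : K ∈ imagUnits) : stem K f z = W := by
  rw [stem, h K hK, h.conj K hK, stemOf_stemEval hK]

theorem stemAnalyticAt_of_functional {K : ℍ[ℝ]} {φ : ℂ → ℍ[ℝ]} {z : ℂ}
    (h : ∀ c : ℍ[ℂ] →ₗ[ℂ] ℂ, AnalyticAt ℂ (fun w => stemFunctional K c (φ w)) z) :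
    StemAnalyticAt (fun w => stemOf K (φ w) 0) z :=
  ⟨h (QuaternionAlgebra.reₗ _ _ _), h (QuaternionAlgebra.imIₗ _ _ _),
    h (QuaternionAlgebra.imJₗ _ _ _), h (QuaternionAlgebra.imKₗ _ _ _)⟩

theorem stemMeromorphicAt_of_functional {K : ℍ[ℝ]} {φ : ℂ → ℍ[ℝ]} {z : ℂ}
    (h : ∀ c : ℍ[ℂ] →ₗ[ℂ] ℂ, MeromorphicAt (fun w => stemFunctional K c (φ w)) z) :
    StemMeromorphicAt (fun w => stemOf K (φ w) 0) z :=
  ⟨h (QuaternionAlgebra.reₗ _ _ _), h (QuaternionAlgebra.imIₗ _ _ _),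
    h (QuaternionAlgebra.imJₗ _ _ _), h (QuaternionAlgebra.imKₗ _ _ _)⟩

theorem SliceRegularOn.stemAnalyticAt {f : ℍ[ℝ] → ℍ[ℝ]} {Ω : Set ℍ[ℝ]} (hf : SliceRegularOn f Ω)
    (hΩ : IsOpen Ω) {K : ℍ[ℝ]} (hK : K ∈ imagUnits)
    {z : ℂ} (hz : slicePt K z ∈ Ω) (hz' : slicePt K (conj z) ∈ Ω) :
    StemAnalyticAt (stem K f) z := by
  have h : ∀ w, slicePt K w ∈ Ω → StemAnalyticAt (fun w => stemOf K (f (slicePt K w)) 0) w :=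
    fun w hw => stemAnalyticAt_of_functional fun c =>
      hf.analyticAt hΩ hK (isSliceLinear_stemFunctional hK c) hw
  have := (h z hz).add (h _ hz').conj_conj
  simpa only [← stem_eq_add] using this

theorem tendsto_ofReal_nhdsNE (r : ℝ) :
    Tendsto (fun x : ℝ => (x : ℂ)) (𝓝[≠] r) (𝓝[≠] (r : ℂ)) :=
  tendsto_nhdsWithin_iff.mpr
    ⟨(Complex.continuous_ofReal.tendsto r).mono_left nhdsWithin_le_nhds, by
      filter_upwards [self_mem_nhdsWithin] with w hw h
      exact hw (Complex.ofReal_injective h)⟩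

theorem IsAxiallySymmetric.slicePt_mem_iff {T : Set ℍ[ℝ]} (hT : IsAxiallySymmetric T)
    {I K : ℍ[ℝ]} (hI : I ∈ imagUnits) (hK : K ∈ imagUnits) {z : ℂ} :
    slicePt K z ∈ T ↔ slicePt I z ∈ T :=
  ⟨fun h => hT z K hK h I hI, fun h => hT z I hI h K hK⟩

theorem IsAxiallySymmetric.slicePt_conj_mem_iff {T : Set ℍ[ℝ]} (hT : IsAxiallySymmetric T)
    {K : ℍ[ℝ]} (hK : K ∈ imagUnits) {z : ℂ} :
    slicePt K (conj z) ∈ T ↔ slicePt K z ∈ T := by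
  rw [← slicePt_neg_unit]
  exact hT.slicePt_mem_iff hK (neg_mem_imagUnits hK)

theorem isPreconnected_preimage_slicePt {T : Set ℍ[ℝ]} {K : ℍ[ℝ]} (hK : K ∈ imagUnits)
    (h : IsPreconnected (T ∩ sliceLine K)) : IsPreconnected (slicePt K ⁻¹' T) := by
  rw [← (slicePt_isometry hK).isUniformInducing.isInducing.isPreconnected_image,
    Set.image_preimage_eq_inter_range]
  exact h

/-- The representation formula. -/
theorem SliceRegularOn.hasStem {f : ℍ[ℝ] → ℍ[ℝ]} {Ω : Set ℍ[ℝ]} (hf : SliceRegularOn f Ω)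
    (hΩ : IsSymmSliceDomain Ω) {I : ℍ[ℝ]} (hI : I ∈ imagUnits) {z : ℂ} (hz : slicePt I z ∈ Ω) :
    HasStem f z (stem I f z) := by
  intro K hK
  rw [← stemEval_stem hK f z]
  congr 1
  obtain ⟨r, hr⟩ := hΩ.1.2.2.1
  have hD : slicePt K ⁻¹' Ω = slicePt I ⁻¹' Ω := Set.ext fun w => hΩ.2.slicePt_mem_iff hI hK
  refine stem_eqOn_of_frequently_eq (D := slicePt I ⁻¹' Ω) (z := r) (fun w hw => ?_)
    (fun w hw => ?_) (isPreconnected_preimage_slicePt hI (hΩ.1.2.2.2 I hI).isPreconnected) ?_ ?_ hz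
  · rw [← hD] at hw
    exact hf.stemAnalyticAt hΩ.1.1 hK hw ((hΩ.2.slicePt_conj_mem_iff hK).mpr hw)
  · exact hf.stemAnalyticAt hΩ.1.1 hI hw ((hΩ.2.slicePt_conj_mem_iff hI).mpr hw)
  · simpa only [Set.mem_preimage, slicePt_ofReal] using hr
  -- At a real point both stems equal the quaternion `f x`, whatever the line; real points
  -- accumulate at `r`.
  · refine (tendsto_ofReal_nhdsNE r).frequently (Eventually.frequently (.of_forall fun x => ?_))
    rw [stem_ofReal, stem_ofReal]

/-! ### Regular functions from analytic stems -/

theorem slicePt_smul (K : ℍ[ℝ]) (r : ℝ) (z : ℂ) : slicePt K (r • z) = r • slicePt K z := by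
  simp only [slicePt, Quaternion.mul_coe_eq_smul, smul_add, Complex.smul_re, Complex.smul_im,
    smul_smul, smul_eq_mul, Quaternion.smul_coe]

/-- The map `c ↦ (x + K y) u` for `c = x + i y`. -/
noncomputable def slicePtMulCLM (K u : ℍ[ℝ]) : ℂ →L[ℝ] ℍ[ℝ] :=
  LinearMap.toContinuousLinearMap
    { toFun := fun c => slicePt K c * u
      map_add' := fun x y => by rw [slicePt_add, add_mul]
      map_smul' := fun r x => by
        rw [slicePt_smul, smul_mul_assoc]
        rfl }

theorem slicePtMulCLM_apply (K u : ℍ[ℝ]) (c : ℂ) : slicePtMulCLM K u c = slicePt K c * u := rfl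

/-- The quaternion `k`. -/
noncomputable def unitK : ℍ[ℝ] := ⟨0, 0, 0, 1⟩

theorem stemEval_eq_sum (K : ℍ[ℝ]) (W : ℍ[ℂ]) :
    stemEval K W = slicePt K W.re * 1 + slicePt K W.imI * unitI + slicePt K W.imJ * unitJ +
      slicePt K W.imK * unitK := by
  have h : ∀ q : ℍ[ℝ], q = (q.re : ℍ[ℝ]) * 1 + (q.imI : ℍ[ℝ]) * unitI + (q.imJ : ℍ[ℝ]) * unitJ +
      (q.imK : ℍ[ℝ]) * unitK := fun q => by
    ext <;>
    simp only [Quaternion.coe_mul_eq_smul, Quaternion.re_add, Quaternion.imI_add,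
      Quaternion.imJ_add, Quaternion.imK_add, Quaternion.re_smul, Quaternion.imI_smul,
      Quaternion.imJ_smul, Quaternion.imK_smul] <;>
    simp [unitI, unitJ, unitK]
  rw [stemEval, h (stemRe W), h (stemIm W)]
  simp only [slicePt, mul_add, add_mul, stemRe_re, stemRe_imI, stemRe_imJ, stemRe_imK, stemIm_re,
    stemIm_imI, stemIm_imJ, stemIm_imK, mul_assoc]
  abel

/-- The constant `u` stands on the right, so complex linearity of the derivative of `g` becomes `L i
= K (L 1)`, and `K * K = -1` gives the regularity equation. -/
theorem exists_hasFDerivAt_slicePt_mul {K : ℍ[ℝ]} (hK : K ∈ imagUnits) (u : ℍ[ℝ]) {g : ℂ → ℂ}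
    {z : ℂ} (hg : AnalyticAt ℂ g z) :
    ∃ L : ℂ →L[ℝ] ℍ[ℝ], HasFDerivAt (fun w => slicePt K (g w) * u) L z ∧
      L 1 + K * L Complex.I = 0 := by
  have hd : DifferentiableAt ℂ g z := hg.differentiableAt
  refine ⟨(slicePtMulCLM K u).comp ((fderiv ℂ g z).restrictScalars ℝ),
    (slicePtMulCLM K u).hasFDerivAt.comp z (hd.hasFDerivAt.restrictScalars ℝ), ?_⟩
  simp only [ContinuousLinearMap.comp_apply, ContinuousLinearMap.coe_restrictScalars',
    slicePtMulCLM_apply]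
  have e : fderiv ℂ g z Complex.I = Complex.I * fderiv ℂ g z 1 := by
    rw [← smul_eq_mul, ← map_smul, smul_eq_mul, mul_one]
  have eI : slicePt K Complex.I = K := by simp [slicePt]
  rw [e, SliceReg.slicePt_mul hK, eI, ← mul_assoc, ← mul_assoc, imagUnits_mul_self hK]
  simp

theorem contDiffAt_slicePt_mul (K u : ℍ[ℝ]) {g : ℂ → ℂ} {z : ℂ} (hg : AnalyticAt ℂ g z) :
    ContDiffAt ℝ 1 (fun w => slicePt K (g w) * u) z :=
  (slicePtMulCLM K u).contDiff.contDiffAt.comp z (hg.contDiffAt.restrict_scalars ℝ)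

theorem sliceRegularOn_of_stem {f : ℍ[ℝ] → ℍ[ℝ]} {Ω : Set ℍ[ℝ]} {F : ℂ → ℍ[ℂ]} (hΩ : IsOpen Ω)
    (hF : ∀ K ∈ imagUnits, ∀ z, slicePt K z ∈ Ω → StemAnalyticAt F z)
    (hf : ∀ K ∈ imagUnits, ∀ z, slicePt K z ∈ Ω → f (slicePt K z) = stemEval K (F z)) :
    SliceRegularOn f Ω := by
  intro K hK
  have ho : IsOpen (slicePt K ⁻¹' Ω) := hΩ.preimage (slicePt_continuous K)
  have hev : ∀ z ∈ slicePt K ⁻¹' Ω, (fun w => f (slicePt K w)) =ᶠ[𝓝 z] fun w =>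
      slicePt K (F w).re * 1 + slicePt K (F w).imI * unitI + slicePt K (F w).imJ * unitJ +
      slicePt K (F w).imK * unitK := fun z hz => by
    filter_upwards [ho.mem_nhds hz] with w hw
    rw [hf K hK w hw, stemEval_eq_sum]
  refine ⟨fun z hz => ContDiffAt.contDiffWithinAt ?_, fun z hz => ?_⟩
  · obtain ⟨h₀, h₁, h₂, h₃⟩ := hF K hK z hz
    refine ContDiffAt.congr_of_eventuallyEq ?_ (hev z hz)
    exact (((contDiffAt_slicePt_mul K 1 h₀).add (contDiffAt_slicePt_mul K unitI h₁)).add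
      (contDiffAt_slicePt_mul K unitJ h₂)).add (contDiffAt_slicePt_mul K unitK h₃)
  · obtain ⟨h₀, h₁, h₂, h₃⟩ := hF K hK z hz
    obtain ⟨L₀, d₀, e₀⟩ := exists_hasFDerivAt_slicePt_mul hK 1 h₀
    obtain ⟨L₁, d₁, e₁⟩ := exists_hasFDerivAt_slicePt_mul hK unitI h₁
    obtain ⟨L₂, d₂, e₂⟩ := exists_hasFDerivAt_slicePt_mul hK unitJ h₂
    obtain ⟨L₃, d₃, e₃⟩ := exists_hasFDerivAt_slicePt_mul hK unitK h₃
    have hd := (((d₀.add d₁).add d₂).add d₃).congr_of_eventuallyEq (hev z hz)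
    rw [hd.fderiv]
    have : (L₀ + L₁ + L₂ + L₃) 1 + K * (L₀ + L₁ + L₂ + L₃) Complex.I =
        (L₀ 1 + K * L₀ Complex.I) + (L₁ 1 + K * L₁ Complex.I) + (L₂ 1 + K * L₂ Complex.I) +
          (L₃ 1 + K * L₃ Complex.I) := by
      simp only [add_apply, mul_add]
      abel
    rw [this, e₀, e₁, e₂, e₃]
    simp

/-! ### Laurent expansions -/

theorem hasSum_congr_of_eq {ι E : Type*} [AddCommMonoid E] [TopologicalSpace E] {f g : ι → E}
    {a : E} (h : ∀ i, f i = g i) : HasSum f a ↔ HasSum g a := by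
  rw [funext h]

theorem stemRe_zero : stemRe 0 = 0 := by ext <;> simp

theorem stemIm_zero : stemIm 0 = 0 := by ext <;> simp

theorem hasSum_int_shift {c : ℤ → ℂ} {m : ℕ} (hc : ∀ k : ℕ, m < k → c (-(k : ℤ)) = 0) {u s : ℂ}
    (hu : u ≠ 0) : HasSum (fun n : ℤ => u ^ n * c n) s ↔
      HasSum (fun k : ℕ => u ^ k * c ((k : ℤ) - m)) (u ^ m * s) := by
  have hm : u ^ m ≠ 0 := pow_ne_zero m hu
  rw [← hasSum_mul_left_iff hm]
  have hinj : Function.Injective (fun k : ℕ => (k : ℤ) - m) := fun a b h => by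
    simpa using h
  rw [← hinj.hasSum_iff]
  · refine hasSum_congr_of_eq fun k => ?_
    simp only [Function.comp_apply]
    rw [← mul_assoc, ← zpow_natCast u m, ← zpow_add₀ hu, add_sub_cancel, zpow_natCast]
  · intro n hn
    have h1 : n + m < 0 := by
      by_contra h
      exact hn ⟨(n + m).toNat, by simp only []; omega⟩
    have h2 := hc (-n).toNat (by omega)
    rw [show -((-n).toNat : ℤ) = n by omega] at h2
    rw [h2, mul_zero, mul_zero]

theorem meromorphicAt_of_hasSum {g : ℂ → ℂ} {z : ℂ} {c : ℤ → ℂ} {m : ℕ}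
    (hc : ∀ k : ℕ, m < k → c (-(k : ℤ)) = 0)
    (h : ∀ᶠ w in 𝓝[≠] z, HasSum (fun n : ℤ => (w - z) ^ n * c n) (g w)) : MeromorphicAt g z := by
  set p : FormalMultilinearSeries ℂ ℂ ℂ :=
    FormalMultilinearSeries.ofScalars ℂ (fun k : ℕ => c ((k : ℤ) - m)) with hp
  have hs : ∀ᶠ w in 𝓝[≠] z,
      HasSum (fun k : ℕ => (w - z) ^ k * c ((k : ℤ) - m)) ((w - z) ^ m * g w) := by
    filter_upwards [h, self_mem_nhdsWithin] with w hw hwz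
    exact (hasSum_int_shift hc (sub_ne_zero.mpr hwz)).mp hw
  have hrad : 0 < p.radius := by
    -- Convergence at a single point `w ≠ z` bounds the radius below, since the terms of the series
    -- tend to zero there.
    obtain ⟨w, hw, hwz⟩ := (hs.and self_mem_nhdsWithin).exists
    have ht := hw.summable.tendsto_atTop_zero.norm
    have hle : ((‖w - z‖₊ : NNReal) : ENNReal) ≤ p.radius := by
      refine p.le_radius_of_tendsto (l := ‖(0 : ℂ)‖) (ht.congr fun k => ?_)
      rw [hp, FormalMultilinearSeries.ofScalars_norm, norm_mul, norm_pow, mul_comm]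
      rfl
    refine lt_of_lt_of_le ?_ hle
    simpa [sub_eq_zero] using hwz
  have ha : AnalyticAt ℂ (fun w => p.sum (w - z)) z := by
    have h0 : AnalyticAt ℂ p.sum (z - z) := by
      rw [sub_self]
      exact (p.hasFPowerSeriesOnBall hrad).analyticAt
    exact h0.fun_comp (f := fun w => w - z) (by fun_prop)
  have hmero : MeromorphicAt (fun w => ((w - z) ^ m)⁻¹ * p.sum (w - z)) z := by
    have := ha.meromorphicAt
    fun_prop
  refine hmero.congr ?_
  filter_upwards [hs, self_mem_nhdsWithin] with w hw hwz
  have e : p.sum (w - z) = (w - z) ^ m * g w := by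
    rw [← hw.tsum_eq]
    refine tsum_congr fun k => ?_
    rw [hp, FormalMultilinearSeries.ofScalars_apply_eq, smul_eq_mul, mul_comm]
  rw [e, ← mul_assoc, inv_mul_cancel₀ (pow_ne_zero m (sub_ne_zero.mpr hwz)), one_mul]

/-- Multiplying by `(w - z) ^ m` removes the pole, and the Taylor series of the result converges on
the whole ball. -/
theorem exists_hasSum_laurent {g : ℂ → ℂ} {z : ℂ} {R : ℝ}
    (hg : ∀ w, w ≠ z → ‖w - z‖ < R → AnalyticAt ℂ g w) (hm : MeromorphicAt g z) :
    ∃ (c : ℤ → ℂ) (m : ℕ), (∀ k : ℕ, m < k → c (-(k : ℤ)) = 0) ∧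
      ∀ w, w ≠ z → ‖w - z‖ < R → HasSum (fun n : ℤ => (w - z) ^ n * c n) (g w) := by
  obtain ⟨m, hm⟩ := hm
  set h : ℂ → ℂ := fun w => (w - z) ^ m • g w with hh
  have hd : DifferentiableOn ℂ h (Metric.ball z R) := by
    intro w hw
    apply DifferentiableAt.differentiableWithinAt
    by_cases hwz : w = z
    · rw [hwz]
      exact hm.differentiableAt
    · have := (hg w hwz (by simpa [dist_eq_norm] using hw)).differentiableAt
      simp only [hh]
      fun_prop
  set a : ℕ → ℂ := fun k => ((k.factorial : ℂ))⁻¹ * iteratedDeriv k h z with ha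
  -- The test `0 ≤ n + m` is needed because `toNat` sends negative integers to `0`.
  set c : ℤ → ℂ := fun n => if 0 ≤ n + m then a (n + m).toNat else 0 with hcdef
  have hc : ∀ k : ℕ, m < k → c (-(k : ℤ)) = 0 := fun k hk => if_neg (by omega)
  refine ⟨c, m, hc, fun w hwz hw => ?_⟩
  rw [hasSum_int_shift hc (sub_ne_zero.mpr hwz)]
  have := Complex.hasSum_taylorSeries_on_ball hd (z := w) (by simpa [dist_eq_norm] using hw)
  refine (hasSum_congr_of_eq fun k => ?_).mp this
  simp only [sub_add_cancel, Int.toNat_natCast, Nat.cast_nonneg, if_true, smul_eq_mul, ha, hcdef]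
  ring

/-- At a real center a function with `g (conj w) = conj (g w)` has real Laurent coefficients. -/
theorem exists_hasSum_laurent_real {g : ℂ → ℂ} {z : ℂ} {R : ℝ}
    (hg : ∀ w, w ≠ z → ‖w - z‖ < R → AnalyticAt ℂ g w) (hm : MeromorphicAt g z) :
    ∃ (c : ℤ → ℂ) (m : ℕ), (∀ k : ℕ, m < k → c (-(k : ℤ)) = 0) ∧
      (∀ w, w ≠ z → ‖w - z‖ < R → HasSum (fun n : ℤ => (w - z) ^ n * c n) (g w)) ∧
      (z.im = 0 → (∀ w, g (conj w) = conj (g w)) → ∀ n, (c n).im = 0) := by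
  obtain ⟨c, m, hc, hs⟩ := exists_hasSum_laurent hg hm
  by_cases hz : z.im = 0 ∧ ∀ w, g (conj w) = conj (g w)
  · obtain ⟨hz, hconj⟩ := hz
    have hzz : conj z = z := Complex.conj_eq_iff_im.mpr hz
    -- Averaging the expansion at `w` with the conjugate of the one at `conj w` replaces the
    -- coefficients by their real parts, without appeal to uniqueness.
    refine ⟨fun n => ((c n).re : ℂ), m, fun k hk => by simp [hc k hk], fun w hwz hw => ?_,
      fun _ _ n => Complex.ofReal_im _⟩
    have h1 := hs w hwz hw
    have hcw : conj w - z = conj (w - z) := by rw [map_sub, hzz]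
    have h2 := hs (conj w) (fun h => hwz (by rw [← Complex.conj_conj w, h, hzz]))
      (by rwa [hcw, Complex.norm_conj])
    rw [hcw, hconj] at h2
    replace h2 := Complex.hasSum_conj.mpr h2
    have h3 := (h1.add h2).mul_left (1 / 2)
    have e : (1 / 2 : ℂ) * (g w + g w) = g w := by ring
    rw [e] at h3
    refine (hasSum_congr_of_eq fun n => ?_).mp h3
    simp only [map_mul, map_zpow₀, Complex.conj_conj, Complex.re_eq_add_conj]
    ring
  · exact ⟨c, m, hc, hs, fun h1 h2 => absurd ⟨h1, h2⟩ hz⟩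

/-- The Laurent expansion of a stem. -/
theorem exists_hasSum_stem {F : ℂ → ℍ[ℂ]} {z : ℂ} {R : ℝ}
    (hF : ∀ w, w ≠ z → ‖w - z‖ < R → StemAnalyticAt F w) (hm : StemMeromorphicAt F z)
    (hconj : ∀ w, F (conj w) = stemConj (F w)) :
    ∃ (B : ℤ → ℍ[ℂ]) (m : ℕ), (∀ k : ℕ, m < k → B (-(k : ℤ)) = 0) ∧
      (∀ w, w ≠ z → ‖w - z‖ < R → ∀ K ∈ imagUnits,
        HasSum (fun n : ℤ => slicePt K ((w - z) ^ n) * stemEval K (B n)) (stemEval K (F w))) ∧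
      (z.im = 0 → ∀ n, stemIm (B n) = 0) := by
  obtain ⟨c₀, m₀, z₀, s₀, r₀⟩ := exists_hasSum_laurent_real (fun w h h' => (hF w h h').1) hm.1
  obtain ⟨c₁, m₁, z₁, s₁, r₁⟩ :=
    exists_hasSum_laurent_real (fun w h h' => (hF w h h').2.1) hm.2.1
  obtain ⟨c₂, m₂, z₂, s₂, r₂⟩ :=
    exists_hasSum_laurent_real (fun w h h' => (hF w h h').2.2.1) hm.2.2.1
  obtain ⟨c₃, m₃, z₃, s₃, r₃⟩ :=
    exists_hasSum_laurent_real (fun w h h' => (hF w h h').2.2.2) hm.2.2.2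
  obtain ⟨B, b₀, b₁, b₂, b₃⟩ : ∃ B : ℤ → ℍ[ℂ], (∀ n, (B n).re = c₀ n) ∧ (∀ n, (B n).imI = c₁ n) ∧
      (∀ n, (B n).imJ = c₂ n) ∧ ∀ n, (B n).imK = c₃ n :=
    ⟨fun n => ⟨c₀ n, c₁ n, c₂ n, c₃ n⟩, fun _ => rfl, fun _ => rfl, fun _ => rfl, fun _ => rfl⟩
  refine ⟨B, m₀ + m₁ + m₂ + m₃, fun k hk => ?_,
    fun w hwz hw K hK => ?_, fun hz n => ?_⟩
  · apply Quaternion.ext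
    · exact (b₀ _).trans (z₀ k (by omega))
    · exact (b₁ _).trans (z₁ k (by omega))
    · exact (b₂ _).trans (z₂ k (by omega))
    · exact (b₃ _).trans (z₃ k (by omega))
  · rw [stemEval_eq_sum]
    have t : ∀ (u : ℍ[ℝ]) (c : ℤ → ℂ) (g : ℂ), HasSum (fun n : ℤ => (w - z) ^ n * c n) g →
        HasSum (fun n : ℤ => slicePt K ((w - z) ^ n) * (slicePt K (c n) * u))
          (slicePt K g * u) := fun u c g h => by
      refine (hasSum_congr_of_eq fun n => ?_).mp (h.mapL (slicePtMulCLM K u))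
      rw [slicePtMulCLM_apply, slicePt_mul hK, mul_assoc]
    refine (hasSum_congr_of_eq fun n => ?_).mp ((((t 1 c₀ _ (s₀ w hwz hw)).add
      (t unitI c₁ _ (s₁ w hwz hw))).add (t unitJ c₂ _ (s₂ w hwz hw))).add
      (t unitK c₃ _ (s₃ w hwz hw)))
    rw [stemEval_eq_sum, mul_add, mul_add, mul_add, b₀, b₁, b₂, b₃]
  · have h : ∀ (d : ℍ[ℂ] → ℂ), (∀ W, d (stemConj W) = conj (d W)) →
        ∀ w, d (F (conj w)) = conj (d (F w)) := fun d hd w => by rw [hconj, hd]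
    apply Quaternion.ext
    · rw [stemIm_re, b₀]
      exact r₀ hz (h (fun W => W.re) fun _ => rfl) n
    · rw [stemIm_imI, b₁]
      exact r₁ hz (h (fun W => W.imI) fun _ => rfl) n
    · rw [stemIm_imJ, b₂]
      exact r₂ hz (h (fun W => W.imJ) fun _ => rfl) n
    · rw [stemIm_imK, b₃]
      exact r₃ hz (h (fun W => W.imK) fun _ => rfl) n

/-! ### Poles in terms of stems -/

theorem slicePt_mem_sigmaShell {K : ℍ[ℝ]} (hK : K ∈ imagUnits) {w z : ℂ} {R : ℝ} (hwz : w ≠ z)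
    (hw : ‖w - z‖ < R) : slicePt K w ∈ sigmaShell (slicePt K z) 0 R := by
  have hs : SameLine (slicePt K w) (slicePt K z) := ⟨K, hK, ⟨w, rfl⟩, ⟨z, rfl⟩⟩
  refine ⟨?_, ?_⟩
  · rw [tauDist, if_pos hs, norm_pos_iff, sub_ne_zero]
    exact fun e => hwz (slicePt_injective hK e)
  · rwa [sigmaDist, if_pos hs, ← slicePt_sub, norm_slicePt hK]

theorem exists_of_mem_sigmaShell_of_ne {K : ℍ[ℝ]} (hK : K ∈ imagUnits) {z : ℂ} {R : ℝ}
    (hz : z.im ≠ 0) (hR : R ≤ |z.im|) {q : ℍ[ℝ]} (hq : q ∈ sigmaShell (slicePt K z) 0 R) :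
    ∃ w, w ≠ z ∧ ‖w - z‖ < R ∧ slicePt K w = q := by
  obtain ⟨hq₁, hq₂⟩ := hq
  -- Off the line of a nonreal `p`, `σ(q, p) ≥ |Im p| ≥ R`, so the shell contains only points of
  -- that line.
  have hs : SameLine q (slicePt K z) := by
    by_contra hs
    rw [sigmaDist, if_neg hs, norm_slicePt_im hK] at hq₂
    have : |z.im| ≤ √((q.re - (slicePt K z).re) ^ 2 + (‖q.im‖ + |z.im|) ^ 2) := by
      refine Real.le_sqrt_of_sq_le ?_
      have h1 : |z.im| ^ 2 ≤ (‖q.im‖ + |z.im|) ^ 2 := by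
        gcongr
        linarith [norm_nonneg q.im]
      linarith [sq_nonneg (q.re - (slicePt K z).re)]
    linarith
  rw [tauDist, if_pos hs] at hq₁
  rw [sigmaDist, if_pos hs] at hq₂
  obtain ⟨I, hI, ⟨w, rfl⟩, ⟨y, hy⟩⟩ := hs
  have e1 : y.im • I = z.im • K := by
    rw [← slicePt_im hI, ← slicePt_im hK, hy]
  have hy0 : y.im ≠ 0 := by
    intro h
    rw [h, zero_smul] at e1
    have h2 := congrArg norm e1
    rw [norm_zero, norm_smul, imagUnits_norm hK, mul_one] at h2
    exact hz (norm_eq_zero.mp h2.symm)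
  -- Two lines sharing a nonreal point coincide, so `q` can be rewritten with the unit `K`.
  have e2 : I = (z.im / y.im) • K := by
    rw [div_eq_inv_mul, mul_smul, ← e1, smul_smul, inv_mul_cancel₀ hy0, one_smul]
  have e3 : slicePt K ⟨w.re, z.im / y.im * w.im⟩ = slicePt I w := by
    simp only [slicePt, Quaternion.mul_coe_eq_smul]
    rw [e2, smul_smul, mul_comm]
  refine ⟨⟨w.re, z.im / y.im * w.im⟩, ?_, ?_, e3⟩
  · rintro h
    rw [← e3, h, sub_self, norm_zero] at hq₁
    exact lt_irrefl _ hq₁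
  · rwa [← e3, ← slicePt_sub, norm_slicePt hK] at hq₂

theorem exists_of_mem_sigmaShell_ofReal {x R : ℝ} {q : ℍ[ℝ]}
    (hq : q ∈ sigmaShell (x : ℍ[ℝ]) 0 R) :
    ∃ K ∈ imagUnits, ∃ w : ℂ, w ≠ x ∧ ‖w - x‖ < R ∧ slicePt K w = q := by
  obtain ⟨K, hK, w, rfl⟩ := exists_slicePt q
  obtain ⟨hq₁, hq₂⟩ := hq
  have hs : SameLine (slicePt K w) x := ⟨K, hK, ⟨w, rfl⟩, ⟨x, slicePt_ofReal K x⟩⟩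
  rw [tauDist, if_pos hs, ← slicePt_ofReal K, ← slicePt_sub, norm_slicePt hK] at hq₁
  rw [sigmaDist, if_pos hs, ← slicePt_ofReal K, ← slicePt_sub, norm_slicePt hK] at hq₂
  exact ⟨K, hK, w, fun h => by simp [h] at hq₁, hq₂, rfl⟩

/-- On the line of `p` a slice-linear functional maps the regular Laurent series termwise to an
ordinary one with finite principal part. -/
theorem IsPole.meromorphicAt {Ω : Set ℍ[ℝ]} {f : ℍ[ℝ] → ℍ[ℝ]} {K : ℍ[ℝ]} (hK : K ∈ imagUnits)
    {z : ℂ} (h : IsPole Ω f (slicePt K z)) {l : ℍ[ℝ] →L[ℝ] ℂ} (hl : IsSliceLinear K l) :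
    MeromorphicAt (fun w => l (f (slicePt K w))) z := by
  obtain ⟨R, hR, -, a, ha, m, hm⟩ := h
  refine meromorphicAt_of_hasSum (c := fun n => l (a n)) (m := m)
    (fun k hk => by rw [hm k hk, map_zero]) ?_
  have h1 : ∀ᶠ w in 𝓝[≠] z, ‖w - z‖ < R := nhdsWithin_le_nhds <| by
    filter_upwards [Metric.ball_mem_nhds z hR] with w hw
    rwa [← dist_eq_norm]
  have h2 : ∀ᶠ w in 𝓝[≠] z, w ≠ conj z := by
    by_cases hz : conj z = z
    · rw [hz]
      exact self_mem_nhdsWithin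
    · exact nhdsWithin_le_nhds (isOpen_ne.mem_nhds (Ne.symm hz))
  filter_upwards [h1, h2, self_mem_nhdsWithin] with w hw hwc hwz
  refine (hasSum_congr_of_eq fun n => ?_).mp ((ha _ (slicePt_mem_sigmaShell hK hwz hw)).mapL l)
  rw [starPow_slicePt hK hwc, hl.slicePt_mul]

theorem IsRemovable.meromorphicAt {Ω : Set ℍ[ℝ]} {f : ℍ[ℝ] → ℍ[ℝ]} {K : ℍ[ℝ]}
    (hK : K ∈ imagUnits) {z : ℂ} (h : IsRemovable Ω f (slicePt K z)) {l : ℍ[ℝ] →L[ℝ] ℂ}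
    (hl : IsSliceLinear K l) : MeromorphicAt (fun w => l (f (slicePt K w))) z := by
  obtain ⟨⟨R, hR, hRΩ⟩, U, g, hU, hpU, hg, hgf⟩ := h
  refine (hg.analyticAt hU hK hl hpU).meromorphicAt.congr ?_
  have h1 : ∀ᶠ w in 𝓝[≠] z, ‖w - z‖ < R := nhdsWithin_le_nhds <| by
    filter_upwards [Metric.ball_mem_nhds z hR] with w hw
    rwa [← dist_eq_norm]
  have h2 : ∀ᶠ w in 𝓝[≠] z, slicePt K w ∈ U := nhdsWithin_le_nhds <|
    (slicePt_continuous K).continuousAt.preimage_mem_nhds (hU.mem_nhds hpU)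
  filter_upwards [h1, h2, self_mem_nhdsWithin] with w hw hwU hwz
  rw [hgf ⟨hwU, hRΩ (slicePt_mem_sigmaShell hK hwz hw)⟩]

theorem isPole_of_stem {Ω : Set ℍ[ℝ]} {f : ℍ[ℝ] → ℍ[ℝ]} {F : ℂ → ℍ[ℂ]} {K : ℍ[ℝ]}
    (hK : K ∈ imagUnits) (hΩ : IsAxiallySymmetric Ω)
    (hf : ∀ w, slicePt K w ∈ Ω → HasStem f w (F w))
    (hF : ∀ w, slicePt K w ∈ Ω → StemAnalyticAt F w) (hconj : ∀ w, F (conj w) = stemConj (F w))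
    {z : ℂ} (hz : ∀ᶠ w in 𝓝[≠] z, slicePt K w ∈ Ω) (hm : StemMeromorphicAt F z) :
    IsPole Ω f (slicePt K z) := by
  obtain ⟨R, hR, hball⟩ : ∃ R > 0, ∀ w, w ≠ z → ‖w - z‖ < R → slicePt K w ∈ Ω := by
    obtain ⟨R, hR, h⟩ := Metric.mem_nhdsWithin_iff.mp hz
    exact ⟨R, hR, fun w hwz hw => h ⟨by rwa [Metric.mem_ball, dist_eq_norm], hwz⟩⟩
  by_cases hz0 : z.im = 0
  · obtain ⟨x, rfl⟩ : ∃ x : ℝ, (x : ℂ) = z := ⟨z.re, Complex.ext rfl hz0.symm⟩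
    obtain ⟨B, m, hB, hs, hr⟩ := exists_hasSum_stem (fun w h h' => hF w (hball w h h')) hm hconj
    rw [slicePt_ofReal]
    -- Around a real center all lines meet the shell, so the coefficients must not depend on the
    -- line. They do not, because `stemIm (B n) = 0`.
    refine ⟨R, hR, fun q hq => ?_, fun n => stemRe (B n), fun q hq => ?_, m, fun k hk => ?_⟩
    · obtain ⟨L, hL, w, hwx, hw, rfl⟩ := exists_of_mem_sigmaShell_ofReal hq
      exact (hΩ.slicePt_mem_iff hK hL).mpr (hball w hwx hw)
    · obtain ⟨L, hL, w, hwx, hw, rfl⟩ := exists_of_mem_sigmaShell_ofReal hq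
      rw [hf w (hball w hwx hw) L hL]
      refine (hasSum_congr_of_eq fun n => ?_).mp (hs w hwx hw L hL)
      rw [starPow_ofReal hL hwx, stemEval, hr hz0, mul_zero, add_zero]
    · simp only [hB k hk, stemRe_zero]
  -- The bound `|z.im|` confines the shell to the line of `K` and keeps it away from `conj z`, which
  -- lies at distance `2 |z.im|`.
  · have hR' : 0 < min R |z.im| := lt_min hR (abs_pos.mpr hz0)
    obtain ⟨B, m, hB, hs, -⟩ := exists_hasSum_stem (R := min R |z.im|)
      (fun w h h' => hF w (hball w h (h'.trans_le (min_le_left _ _)))) hm hconj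
    refine ⟨_, hR', fun q hq => ?_, fun n => stemEval K (B n), fun q hq => ?_, m, fun k hk => ?_⟩
    · obtain ⟨w, hwz, hw, rfl⟩ := exists_of_mem_sigmaShell_of_ne hK hz0 (min_le_right _ _) hq
      exact hball w hwz (hw.trans_le (min_le_left _ _))
    · obtain ⟨w, hwz, hw, rfl⟩ := exists_of_mem_sigmaShell_of_ne hK hz0 (min_le_right _ _) hq
      rw [hf w (hball w hwz (hw.trans_le (min_le_left _ _))) K hK]
      refine (hasSum_congr_of_eq fun n => ?_).mp (hs w hwz hw K hK)
      rw [starPow_slicePt hK]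
      rintro rfl
      have h2 : |2 * z.im| < |z.im| := by
        refine lt_of_le_of_lt ?_ (hw.trans_le (min_le_right _ _))
        refine le_trans (le_of_eq ?_) (Complex.abs_im_le_norm _)
        rw [Complex.sub_im, Complex.conj_im, ← abs_neg]
        ring_nf
      rw [abs_mul, abs_two] at h2
      linarith [abs_nonneg z.im]
    · simp only [hB k hk, stemEval, stemRe_zero, stemIm_zero, mul_zero, add_zero]

/-- The stem involves the values at `x + K y` and `x - K y`. Both points lie in `Ω` by symmetry, and
each is a regular point, a pole or a removable singularity. -/
theorem SemiregularFun.stemMeromorphicAt {Ω : Set ℍ[ℝ]} (hΩ : IsAxiallySymmetric Ω)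
    (f : SemiregularFun Ω) {K : ℍ[ℝ]} (hK : K ∈ imagUnits) {z : ℂ} (hz : slicePt K z ∈ Ω) :
    StemMeromorphicAt (stem K f.toFun) z := by
  have h : ∀ w, slicePt K w ∈ Ω →
      StemMeromorphicAt (fun w => stemOf K (f.toFun (slicePt K w)) 0) w := fun w hw =>
    stemMeromorphicAt_of_functional fun c => by
      have hl := isSliceLinear_stemFunctional hK c
      by_cases hd : slicePt K w ∈ f.dom
      · exact (f.regular.analyticAt f.symm_dom.1.1 hK hl hd).meromorphicAt
      · rcases f.pole _ ⟨hw, hd⟩ with hp | hp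
        · exact hp.meromorphicAt hK hl
        · exact hp.meromorphicAt hK hl
  have := (h z hz).add (h _ ((hΩ.slicePt_conj_mem_iff hK).mpr hz)).conj_conj
  simpa only [← stem_eq_add] using this

/-! ### Open sets with isolated points removed -/

theorem isPreconnected_ball_diff_singleton (z : ℂ) (R : ℝ) :
    IsPreconnected (Metric.ball z R \ {z}) := by
  have h : Metric.ball z R \ {z} =
      (fun p : ℝ × ℝ => z + p.1 * Complex.exp (p.2 * Complex.I)) '' (Set.Ioo 0 R ×ˢ Set.univ) := by
    ext w
    constructor
    · rintro ⟨hw, hwz⟩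
      have hw' : w - z ≠ 0 := sub_ne_zero.mpr hwz
      refine ⟨(‖w - z‖, Complex.arg (w - z)), ⟨⟨norm_pos_iff.mpr hw', ?_⟩, trivial⟩, ?_⟩
      · rwa [Metric.mem_ball, dist_eq_norm] at hw
      · simp only [Complex.norm_mul_exp_arg_mul_I, add_sub_cancel]
    · rintro ⟨⟨t, θ⟩, ⟨⟨h0, hR⟩, -⟩, rfl⟩
      have hn : ‖(t : ℂ) * Complex.exp (θ * Complex.I)‖ = t := by
        rw [norm_mul, Complex.norm_exp_ofReal_mul_I, mul_one, Complex.norm_real, Real.norm_eq_abs,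
          abs_of_pos h0]
      refine ⟨?_, fun h => ?_⟩
      · rwa [Metric.mem_ball, dist_eq_norm, add_sub_cancel_left, hn]
      · rw [Set.mem_singleton_iff, add_eq_left] at h
        simp only [h, norm_zero] at hn
        exact h0.ne hn
  rw [h]
  exact (isPreconnected_Ioo.prod isPreconnected_univ).image _ (by fun_prop)

/-- Punctured discs are connected, so a separation of `W` assigns every point of `U`, missing or
not, to one side. This would separate `U`. -/
theorem isPreconnected_of_eventually_mem {U W : Set ℂ} (hU : IsPreconnected U) (hWU : W ⊆ U)
    (h : ∀ z ∈ U, ∀ᶠ w in 𝓝[≠] z, w ∈ W) : IsPreconnected W := by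
  have hW : IsOpen W := by
    rw [isOpen_iff_mem_nhds]
    intro z hz
    have hWz : W ∈ 𝓝[≠] z := h z (hWU hz)
    have := insert_mem_nhds_iff.mpr hWz
    rwa [Set.insert_eq_of_mem hz] at this
  intro u v hu hv hWuv hWu hWv
  by_contra hne
  rw [Set.not_nonempty_iff_eq_empty] at hne
  have hdisj : Disjoint (W ∩ u) (W ∩ v) := by
    rw [Set.disjoint_iff_inter_eq_empty, ← Set.inter_inter_distrib_left]
    exact hne
  have hself : ∀ t : Set ℂ, IsOpen t → (W ∩ t).Nonempty →
      (U ∩ {z | ∀ᶠ w in 𝓝[≠] z, w ∈ W ∩ t}).Nonempty := fun t ht ⟨x, hx⟩ =>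
    ⟨x, hWU hx.1, nhdsWithin_le_nhds ((hW.inter ht).mem_nhds hx)⟩
  obtain ⟨z, -, h1, h2⟩ := hU _ _ isOpen_setOfPred_eventually_nhdsWithin
    isOpen_setOfPred_eventually_nhdsWithin (fun z hz => by
      obtain ⟨R, hR, hball⟩ := Metric.mem_nhdsWithin_iff.mp (h z hz)
      have hmem : Metric.ball z R \ {z} ∈ 𝓝[≠] z :=
        sdiff_mem_nhdsWithin_compl (Metric.ball_mem_nhds z hR) _
      have hcover : Metric.ball z R \ {z} ⊆ W ∩ u ∪ W ∩ v := fun w hw => by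
        rw [← Set.inter_union_distrib_left]
        exact ⟨hball hw, hWuv (hball hw)⟩
      rcases (isPreconnected_ball_diff_singleton z R).subset_or_subset (hW.inter hu) (hW.inter hv)
        hdisj hcover with hs | hs
      · exact Or.inl (mem_of_superset hmem hs)
      · exact Or.inr (mem_of_superset hmem hs)) (hself u hu hWu) (hself v hv hWv)
  have h1' : ∀ᶠ w in 𝓝[≠] z, w ∈ W ∩ u := h1
  obtain ⟨w, hw1, hw2⟩ := (h1'.and h2).exists
  exact Set.disjoint_left.mp hdisj hw1 hw2

theorem isSymmSliceDomain_of_eventually_mem {Ω D : Set ℍ[ℝ]} (hΩ : IsSymmSliceDomain Ω)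
    (hDΩ : D ⊆ Ω) (hD : IsOpen D) (hDs : IsAxiallySymmetric D)
    (h : ∀ z, slicePt unitI z ∈ Ω → ∀ᶠ w in 𝓝[≠] z, slicePt unitI w ∈ D) :
    IsSymmSliceDomain D := by
  obtain ⟨r, hr⟩ := hΩ.1.2.2.1
  obtain ⟨x, hx⟩ : ∃ x : ℝ, (x : ℍ[ℝ]) ∈ D := by
    have := (tendsto_ofReal_nhdsNE r).eventually (h r (by rwa [slicePt_ofReal]))
    obtain ⟨x, hx⟩ := this.exists
    exact ⟨x, by rwa [slicePt_ofReal] at hx⟩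
  have hs : ∀ K ∈ imagUnits, IsPreconnected (D ∩ sliceLine K) := fun K hK => by
    have hp := isPreconnected_of_eventually_mem (W := slicePt K ⁻¹' D)
      (isPreconnected_preimage_slicePt hK (hΩ.1.2.2.2 K hK).isPreconnected)
      (Set.preimage_mono hDΩ) (fun z hz => by
        filter_upwards [h z ((hΩ.2.slicePt_mem_iff unitI_mem hK).mp hz)] with w hw
        exact (hDs.slicePt_mem_iff unitI_mem hK).mpr hw)
    have := hp.image _ (slicePt_continuous K).continuousOn
    rwa [Set.image_preimage_eq_inter_range] at this
  have hxs : ∀ K : ℍ[ℝ], (x : ℍ[ℝ]) ∈ D ∩ sliceLine K := fun K =>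
    ⟨hx, x, slicePt_ofReal K x⟩
  refine ⟨⟨hD, ⟨⟨x, hx⟩, ?_⟩, ⟨x, hx⟩, fun K hK => ⟨⟨x, hxs K⟩, hs K hK⟩⟩, hDs⟩
  -- Every point is joined inside its own slice to the real point `x`, which all slices share.
  refine isPreconnected_of_forall (x : ℍ[ℝ]) fun q hq => ?_
  obtain ⟨K, hK, z, rfl⟩ := exists_slicePt q
  exact ⟨_, Set.inter_subset_left, hxs K, ⟨hq, z, rfl⟩, hs K hK⟩

/-- The common source of constants, sums, products and inverses. Missing points all count as poles,
since order zero is allowed. -/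
theorem exists_semiregularFun {Ω : Set ℍ[ℝ]} (hΩ : IsSymmSliceDomain Ω) {D : Set ℍ[ℝ]}
    (hDΩ : D ⊆ Ω) (hD : IsOpen D) (hDs : IsAxiallySymmetric D)
    (h : ∀ z, slicePt unitI z ∈ Ω → ∀ᶠ w in 𝓝[≠] z, slicePt unitI w ∈ D)
    {F : ℂ → ℍ[ℂ]} {f : ℍ[ℝ] → ℍ[ℝ]} (hconj : ∀ w, F (conj w) = stemConj (F w))
    (hF : ∀ w, slicePt unitI w ∈ D → StemAnalyticAt F w)
    (hm : ∀ z, slicePt unitI z ∈ Ω → StemMeromorphicAt F z)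
    (hf : ∀ w, slicePt unitI w ∈ D → HasStem f w (F w)) :
    ∃ g : SemiregularFun Ω, g.dom = D ∧ g.toFun = f := by
  have hDi : ∀ K ∈ imagUnits, ∀ w, slicePt K w ∈ D → slicePt unitI w ∈ D := fun K hK w hw =>
    (hDs.slicePt_mem_iff unitI_mem hK).mp hw
  refine ⟨⟨D, f, hDΩ, isSymmSliceDomain_of_eventually_mem hΩ hDΩ hD hDs h,
    sliceRegularOn_of_stem hD (fun K hK z hz => hF z (hDi K hK z hz))
      (fun K hK z hz => hf z (hDi K hK z hz) K hK), fun p hp => Or.inl ?_⟩, rfl, rfl⟩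
  obtain ⟨K, hK, z, rfl⟩ := exists_slicePt p
  have hz : slicePt unitI z ∈ Ω := (hΩ.2.slicePt_mem_iff unitI_mem hK).mp hp.1
  refine isPole_of_stem hK hDs (fun w hw => hf w (hDi K hK w hw)) (fun w hw => hF w (hDi K hK w hw))
    hconj ?_ (hm z hz)
  filter_upwards [h z hz] with w hw
  exact (hDs.slicePt_mem_iff unitI_mem hK).mpr hw

/-! ### Operations on semiregular functions -/

namespace SemiregularFun

variable {Ω : Set ℍ[ℝ]}

theorem hasStem (f : SemiregularFun Ω) {w : ℂ} (hw : slicePt unitI w ∈ f.dom) :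
    HasStem f.toFun w (stem unitI f.toFun w) :=
  f.regular.hasStem f.symm_dom unitI_mem hw

theorem stemAnalyticAt (f : SemiregularFun Ω) {w : ℂ} (hw : slicePt unitI w ∈ f.dom) :
    StemAnalyticAt (stem unitI f.toFun) w :=
  f.regular.stemAnalyticAt f.symm_dom.1.1 unitI_mem hw
    ((f.symm_dom.2.slicePt_conj_mem_iff unitI_mem).mpr hw)

theorem isAxiallySymmetric_inter (f g : SemiregularFun Ω) :
    IsAxiallySymmetric (f.dom ∩ g.dom) := fun z I hI hz J hJ =>
  ⟨f.symm_dom.2 z I hI hz.1 J hJ, g.symm_dom.2 z I hI hz.2 J hJ⟩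

theorem eventually_mem_inter (f g : SemiregularFun Ω) {z : ℂ} (hz : slicePt unitI z ∈ Ω) :
    ∀ᶠ w in 𝓝[≠] z, slicePt unitI w ∈ f.dom ∩ g.dom :=
  (f.eventually_mem_dom unitI_mem hz).and (g.eventually_mem_dom unitI_mem hz)

theorem exists_const (hΩ : IsSymmSliceDomain Ω) (c : ℍ[ℝ]) :
    ∃ h : SemiregularFun Ω, h.dom = Ω ∧ h.toFun = fun _ => c := by
  have ha : ∀ z, StemAnalyticAt (fun _ => stemMk c 0) z := fun z =>
    ⟨analyticAt_const, analyticAt_const, analyticAt_const, analyticAt_const⟩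
  refine exists_semiregularFun hΩ subset_rfl hΩ.1.1 hΩ.2 (fun z hz => nhdsWithin_le_nhds ?_)
    (F := fun _ => stemMk c 0) (fun w => stem_ext (by simp) (by simp)) (fun w _ => ha w)
    (fun w _ => (ha w).meromorphicAt) (fun w _ => hasStem_const c w)
  exact (slicePt_continuous _).continuousAt.preimage_mem_nhds (hΩ.1.1.mem_nhds hz)

theorem exists_add (hΩ : IsSymmSliceDomain Ω) (f g : SemiregularFun Ω) :
    ∃ h : SemiregularFun Ω, h.dom = f.dom ∩ g.dom ∧ h.toFun = fun q => f.toFun q + g.toFun q :=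
  exists_semiregularFun hΩ (Set.inter_subset_left.trans f.dom_subset)
    (f.symm_dom.1.1.inter g.symm_dom.1.1) (f.isAxiallySymmetric_inter g)
    (fun _ hz => f.eventually_mem_inter g hz)
    (F := fun w => stem unitI f.toFun w + stem unitI g.toFun w)
    (fun w => by rw [stemConj_add, stemConj_stem, stemConj_stem])
    (fun _ hw => (f.stemAnalyticAt hw.1).add (g.stemAnalyticAt hw.2))
    (fun _ hz => (f.stemMeromorphicAt hΩ.2 unitI_mem hz).add
      (g.stemMeromorphicAt hΩ.2 unitI_mem hz))
    (fun w hw K hK => by rw [f.hasStem hw.1 K hK, g.hasStem hw.2 K hK, stemEval_add])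

theorem exists_starMul (hΩ : IsSymmSliceDomain Ω) (f g : SemiregularFun Ω) :
    ∃ h : SemiregularFun Ω, h.dom = f.dom ∩ g.dom ∧
      h.toFun = starMul unitI unitJ f.toFun g.toFun :=
  exists_semiregularFun hΩ (Set.inter_subset_left.trans f.dom_subset)
    (f.symm_dom.1.1.inter g.symm_dom.1.1) (f.isAxiallySymmetric_inter g)
    (fun _ hz => f.eventually_mem_inter g hz)
    (F := fun w => stem unitI f.toFun w * stem unitI g.toFun w)
    (fun w => by rw [stemConj_mul, stemConj_stem, stemConj_stem])
    (fun _ hw => (f.stemAnalyticAt hw.1).mul (g.stemAnalyticAt hw.2))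
    (fun _ hz => (f.stemMeromorphicAt hΩ.2 unitI_mem hz).mul
      (g.stemMeromorphicAt hΩ.2 unitI_mem hz))
    (fun _ hw => (f.hasStem hw.1).starMul unitI_mem unitJ_mem unitJ_mul_unitI (g.hasStem hw.2))

end SemiregularFun

/-! ### The inverse of a semiregular function -/

/-- The union of the spheres through the points of a subset of the plane. -/
def sphereSet (D : Set ℂ) : Set ℍ[ℝ] := {q | (⟨q.re, ‖q.im‖⟩ : ℂ) ∈ D}

theorem slicePt_mem_sphereSet {D : Set ℂ} (hD : ∀ z, conj z ∈ D ↔ z ∈ D) {K : ℍ[ℝ]}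
    (hK : K ∈ imagUnits) {z : ℂ} : slicePt K z ∈ sphereSet D ↔ z ∈ D := by
  have e : slicePt K z ∈ sphereSet D ↔ (⟨z.re, |z.im|⟩ : ℂ) ∈ D := by
    rw [← slicePt_re hK, ← norm_slicePt_im hK]
    rfl
  rw [e]
  rcases abs_cases z.im with ⟨h, -⟩ | ⟨h, -⟩
  · rw [h]
  · rw [h, ← hD z]
    rfl

theorem isOpen_sphereSet {D : Set ℂ} (hD : IsOpen D) : IsOpen (sphereSet D) := by
  refine hD.preimage (f := fun q : ℍ[ℝ] => (⟨q.re, ‖q.im‖⟩ : ℂ)) ?_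
  have h : Continuous fun q : ℍ[ℝ] => Complex.equivRealProdCLM.symm (q.re, ‖q.im‖) :=
    Complex.equivRealProdCLM.symm.continuous.comp
      (Quaternion.continuous_re.prodMk Quaternion.continuous_im.norm)
  exact h

theorem isAxiallySymmetric_sphereSet {D : Set ℂ} (hD : ∀ z, conj z ∈ D ↔ z ∈ D) :
    IsAxiallySymmetric (sphereSet D) := fun _ _ hI hz _ hJ =>
  (slicePt_mem_sphereSet hD hJ).mpr ((slicePt_mem_sphereSet hD hI).mp hz)

theorem normSq_stemConj (W : ℍ[ℂ]) :
    Quaternion.normSq (stemConj W) = conj (Quaternion.normSq W) := by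
  simp [Quaternion.normSq_def']

theorem normSq_stemMk_zero (q : ℍ[ℝ]) :
    Quaternion.normSq (stemMk q 0) = ((Quaternion.normSq q : ℝ) : ℂ) := by
  have h : ∀ x : ℝ, (⟨x, 0⟩ : ℂ) = x := fun _ => rfl
  simp [Quaternion.normSq_def', stemMk_re, stemMk_imI, stemMk_imJ, stemMk_imK, h]

namespace SemiregularFun

variable {Ω : Set ℍ[ℝ]}

/-- Semiregular functions whose stems agree near a point of `Ω` agree on the common domain. -/
theorem eqOn_of_stem_eventuallyEq (hΩ : IsSymmSliceDomain Ω) (f g : SemiregularFun Ω) {z : ℂ}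
    (hz : slicePt unitI z ∈ Ω)
    (h : stem unitI f.toFun =ᶠ[𝓝[≠] z] stem unitI g.toFun) :
    Set.EqOn (stem unitI f.toFun) (stem unitI g.toFun) (slicePt unitI ⁻¹' (f.dom ∩ g.dom)) := by
  have hD : IsSymmSliceDomain (f.dom ∩ g.dom) := isSymmSliceDomain_of_eventually_mem hΩ
    (Set.inter_subset_left.trans f.dom_subset) (f.symm_dom.1.1.inter g.symm_dom.1.1)
    (f.isAxiallySymmetric_inter g) fun _ hz => f.eventually_mem_inter g hz
  -- The point `z` itself may be missing from a domain, so the identity theorem is started at a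
  -- nearby `y`.
  obtain ⟨y, hy, hyD⟩ := ((eventually_nhdsNE_eventually_nhds_iff.mpr h).and
    (f.eventually_mem_inter g hz)).exists
  exact stem_eqOn_of_frequently_eq (fun w hw => f.stemAnalyticAt hw.1)
    (fun w hw => g.stemAnalyticAt hw.2)
    (isPreconnected_preimage_slicePt unitI_mem (hD.1.2.2.2 _ unitI_mem).isPreconnected) hyD
    (hy.filter_mono nhdsWithin_le_nhds).frequently

theorem equiv_iff (hΩ : IsSymmSliceDomain Ω) (f g : SemiregularFun Ω) {z : ℂ}
    (hz : slicePt unitI z ∈ Ω) :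
    f ≈ g ↔ stem unitI f.toFun =ᶠ[𝓝[≠] z] stem unitI g.toFun := by
  constructor
  · intro h
    filter_upwards [f.eventually_mem_inter g hz] with w hw
    have hw' := ((f.isAxiallySymmetric_inter g).slicePt_conj_mem_iff unitI_mem).mpr hw
    rw [stem, stem, h hw, h hw']
  · intro h q hq
    obtain ⟨K, hK, w, rfl⟩ := exists_slicePt q
    have hw := ((f.isAxiallySymmetric_inter g).slicePt_mem_iff unitI_mem hK).mp hq
    rw [f.hasStem hw.1 K hK, g.hasStem hw.2 K hK,
      f.eqOn_of_stem_eventuallyEq hΩ g hz h hw]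

theorem stem_eventuallyEq (h : SemiregularFun Ω) {F : ℂ → ℍ[ℂ]} {D : Set ℍ[ℝ]}
    (hD : h.dom = D) (hF : ∀ w, slicePt unitI w ∈ D → HasStem h.toFun w (F w)) {z : ℂ}
    (hz : slicePt unitI z ∈ Ω) : stem unitI h.toFun =ᶠ[𝓝[≠] z] F := by
  filter_upwards [h.eventually_mem_dom unitI_mem hz] with w hw
  exact (hF w (hD ▸ hw)).stem_eq unitI_mem

theorem preimage_dom_isPreconnected (f : SemiregularFun Ω) :
    IsPreconnected (slicePt unitI ⁻¹' f.dom) :=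
  isPreconnected_preimage_slicePt unitI_mem (f.symm_dom.1.2.2.2 _ unitI_mem).isPreconnected

/-- The symmetrization vanishes identically only for the zero function. -/
theorem stem_eq_zero_of_normSq (f : SemiregularFun Ω)
    (h : ∀ w, slicePt unitI w ∈ f.dom → Quaternion.normSq (stem unitI f.toFun w) = 0) :
    ∀ w, slicePt unitI w ∈ f.dom → stem unitI f.toFun w = 0 := by
  obtain ⟨r, hr⟩ := f.symm_dom.1.2.2.1
  have hr' : slicePt unitI r ∈ f.dom := by rwa [slicePt_ofReal]
  refine stem_eqOn_of_frequently_eq (G := fun _ => 0) (z := r) (fun w hw => f.stemAnalyticAt hw)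
    (fun w _ => ⟨analyticAt_const, analyticAt_const, analyticAt_const, analyticAt_const⟩)
    f.preimage_dom_isPreconnected hr' ?_
  -- On the real axis the stem is a real quaternion, for which zero norm does force the value zero.
  -- This fails for general elements of `ℍ[ℂ]`.
  refine (tendsto_ofReal_nhdsNE r).frequently (Eventually.frequently ?_)
  filter_upwards [(tendsto_ofReal_nhdsNE r).eventually
    (f.eventually_mem_dom unitI_mem (f.dom_subset hr'))] with x hx
  have h0 := h x hx
  rw [stem_ofReal, normSq_stemMk_zero, Complex.ofReal_eq_zero, Quaternion.normSq_eq_zero] at h0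
  rw [stem_ofReal, h0]
  exact stem_ext (by rw [stemRe_zero]; rfl) (by rw [stemIm_zero]; rfl)

/-- A meromorphic function is, near a point, either identically zero or nowhere zero on a punctured
neighborhood. The first case would spread over the connected slice of the domain and make the stem
vanish. -/
theorem eventually_normSq_ne_zero (hΩ : IsAxiallySymmetric Ω) (f : SemiregularFun Ω)
    (hf : ∃ w, slicePt unitI w ∈ f.dom ∧ stem unitI f.toFun w ≠ 0) {z : ℂ}
    (hz : slicePt unitI z ∈ Ω) :
    ∀ᶠ w in 𝓝[≠] z, Quaternion.normSq (stem unitI f.toFun w) ≠ 0 := by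
  have hm := (f.stemMeromorphicAt hΩ unitI_mem hz).normSq
  refine hm.eventually_eq_zero_or_eventually_ne_zero.resolve_left fun h => ?_
  obtain ⟨y, hy, hyD⟩ := ((eventually_nhdsNE_eventually_nhds_iff.mpr h).and
    (f.eventually_mem_dom unitI_mem hz)).exists
  have h0 : Set.EqOn (fun w => Quaternion.normSq (stem unitI f.toFun w)) (fun _ => 0)
      (slicePt unitI ⁻¹' f.dom) :=
    AnalyticOnNhd.eqOn_of_preconnected_of_frequently_eq (𝕜 := ℂ)
      (fun w hw => (f.stemAnalyticAt hw).normSq) (fun w _ => analyticAt_const)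
      f.preimage_dom_isPreconnected hyD (hy.filter_mono nhdsWithin_le_nhds).frequently
  obtain ⟨w, hw, hne⟩ := hf
  exact hne (f.stem_eq_zero_of_normSq (fun w hw => h0 hw) w hw)

theorem exists_starInv (hΩ : IsSymmSliceDomain Ω) (f : SemiregularFun Ω)
    (hf : ∃ w, slicePt unitI w ∈ f.dom ∧ stem unitI f.toFun w ≠ 0) :
    ∃ h : SemiregularFun Ω, ∀ z, slicePt unitI z ∈ Ω → stem unitI h.toFun =ᶠ[𝓝[≠] z] fun w =>
      (((Quaternion.normSq (stem unitI f.toFun w))⁻¹ : ℂ) : ℍ[ℂ]) * star (stem unitI f.toFun w) := by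
  set N : ℂ → ℂ := fun w => Quaternion.normSq (stem unitI f.toFun w) with hN
  -- The domain of the inverse: the zeros of the symmetrization are removed. Conjugation invariance
  -- makes `D` the trace of an axially symmetric set.
  set D : Set ℂ := slicePt unitI ⁻¹' f.dom ∩ N ⁻¹' {0}ᶜ with hDdef
  have hNc : ∀ w, N (conj w) = conj (N w) := fun w => by
    simp only [hN]
    rw [← stemConj_stem, normSq_stemConj]
  have hDc : ∀ z, conj z ∈ D ↔ z ∈ D := fun z => by
    simp only [hDdef, Set.mem_inter_iff, Set.mem_preimage, Set.mem_compl_iff,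
      Set.mem_singleton_iff, hNc, map_eq_zero, f.symm_dom.2.slicePt_conj_mem_iff unitI_mem]
  have hDo : IsOpen D := by
    refine ContinuousOn.isOpen_inter_preimage (fun w hw => ?_)
      (f.symm_dom.1.1.preimage (slicePt_continuous _)) isOpen_compl_singleton
    exact (f.stemAnalyticAt hw).normSq.continuousAt.continuousWithinAt
  have hmem : ∀ {K : ℍ[ℝ]}, K ∈ imagUnits → ∀ {z}, slicePt K z ∈ sphereSet D ↔ z ∈ D :=
    fun hK => slicePt_mem_sphereSet hDc hK
  have hst : ∀ w, slicePt unitI w ∈ sphereSet D → HasStem (starInv unitI unitJ f.toFun) w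
      ((((N w)⁻¹ : ℂ) : ℍ[ℂ]) * star (stem unitI f.toFun w)) := fun w hw =>
    (f.hasStem ((hmem unitI_mem).mp hw).1).starInv unitI_mem unitJ_mem unitJ_mul_unitI
  obtain ⟨h, hh, hh'⟩ := exists_semiregularFun hΩ (D := sphereSet D)
    (F := fun w => (((N w)⁻¹ : ℂ) : ℍ[ℂ]) * star (stem unitI f.toFun w))
    (f := starInv unitI unitJ f.toFun)
    (fun q hq => by
      obtain ⟨K, hK, z, rfl⟩ := exists_slicePt q
      exact f.dom_subset ((f.symm_dom.2.slicePt_mem_iff unitI_mem hK).mpr ((hmem hK).mp hq).1))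
    (isOpen_sphereSet hDo) (isAxiallySymmetric_sphereSet hDc)
    (fun z hz => by
      filter_upwards [f.eventually_mem_dom unitI_mem hz, f.eventually_normSq_ne_zero hΩ.2 hf hz]
        with w h1 h2
      exact (hmem unitI_mem).mpr ⟨h1, h2⟩)
    (fun w => by
      rw [stemConj_mul, stemConj_coe, stemConj_star, stemConj_stem, hNc, map_inv₀])
    (fun w hw => by
      have hw := (hmem unitI_mem).mp hw
      have ha := f.stemAnalyticAt hw.1
      exact (stemAnalyticAt_coe (ha.normSq.inv hw.2)).mul ha.star)
    (fun w hw => by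
      have ha := f.stemMeromorphicAt hΩ.2 unitI_mem hw
      exact (stemMeromorphicAt_coe ha.normSq.inv).mul ha.star) hst
  exact ⟨h, fun z hz => h.stem_eventuallyEq hh (hh' ▸ hst) hz⟩

end SemiregularFun

/-! ### The division ring -/

section DivisionRing

variable {Ω : Set ℍ[ℝ]} {r : ℝ}

/-- The germ of the stem at the real point `r`. -/
noncomputable def stemGerm (r : ℝ) (f : SemiregularFun Ω) : (𝓝[≠] (r : ℂ)).Germ ℍ[ℂ] :=
  ((stem unitI f.toFun : ℂ → ℍ[ℂ]) : (𝓝[≠] (r : ℂ)).Germ ℍ[ℂ])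

/-- Punctured neighborhoods make the germ insensitive to a pole at `r` and to the differing domains
of `f` and `g`. -/
theorem stemGerm_eq_iff (hΩ : IsSymmSliceDomain Ω) (hr : (r : ℍ[ℝ]) ∈ Ω)
    (f g : SemiregularFun Ω) : stemGerm r f = stemGerm r g ↔ f ≈ g := by
  rw [f.equiv_iff hΩ g (z := r) (by rwa [slicePt_ofReal])]
  exact Germ.coe_eq

theorem stemGerm_eq_coe (hr : (r : ℍ[ℝ]) ∈ Ω) (h : SemiregularFun Ω)
    {F : ℂ → ℍ[ℂ]} {D : Set ℍ[ℝ]} (hD : h.dom = D)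
    (hF : ∀ w, slicePt unitI w ∈ D → HasStem h.toFun w (F w)) :
    stemGerm r h = (F : (𝓝[≠] (r : ℂ)).Germ ℍ[ℂ]) :=
  Germ.coe_eq.mpr (h.stem_eventuallyEq hD hF (by rwa [slicePt_ofReal]))

theorem stemGerm_add (hr : (r : ℍ[ℝ]) ∈ Ω) {f g h : SemiregularFun Ω}
    (hd : h.dom = f.dom ∩ g.dom) (hh : h.toFun = fun q => f.toFun q + g.toFun q) :
    stemGerm r f + stemGerm r g = stemGerm r h :=
  (stemGerm_eq_coe hr h hd (F := fun w => stem unitI f.toFun w + stem unitI g.toFun w)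
    (fun w hw K hK => by
      rw [hh, stemEval_add, ← f.hasStem hw.1 K hK, ← g.hasStem hw.2 K hK])).symm

theorem stemGerm_mul (hr : (r : ℍ[ℝ]) ∈ Ω) {f g h : SemiregularFun Ω}
    (hd : h.dom = f.dom ∩ g.dom) (hh : h.toFun = starMul unitI unitJ f.toFun g.toFun) :
    stemGerm r f * stemGerm r g = stemGerm r h :=
  (stemGerm_eq_coe hr h hd (F := fun w => stem unitI f.toFun w * stem unitI g.toFun w)
    (fun _ hw => hh ▸ (f.hasStem hw.1).starMul unitI_mem unitJ_mem unitJ_mul_unitI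
      (g.hasStem hw.2))).symm

theorem exists_stemGerm_const (hΩ : IsSymmSliceDomain Ω) (hr : (r : ℍ[ℝ]) ∈ Ω) (c : ℍ[ℝ]) :
    ∃ h : SemiregularFun Ω,
      stemGerm r h = ((fun _ => stemMk c 0 : ℂ → ℍ[ℂ]) : (𝓝[≠] (r : ℂ)).Germ ℍ[ℂ]) := by
  obtain ⟨h, hd, hh⟩ := SemiregularFun.exists_const hΩ c
  exact ⟨h, stemGerm_eq_coe hr h hd fun w _ => hh ▸ hasStem_const c w⟩

theorem exists_stemGerm_inv (hΩ : IsSymmSliceDomain Ω) (hr : (r : ℍ[ℝ]) ∈ Ω)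
    (f : SemiregularFun Ω) (hf : stemGerm r f ≠ 0) :
    ∃ h : SemiregularFun Ω, stemGerm r f * stemGerm r h = 1 ∧ stemGerm r h * stemGerm r f = 1 := by
  have hr' : slicePt unitI r ∈ Ω := by rwa [slicePt_ofReal]
  have hf' : ∃ w, slicePt unitI w ∈ f.dom ∧ stem unitI f.toFun w ≠ 0 := by
    by_contra hcon
    push Not at hcon
    refine hf (Germ.coe_eq.mpr ?_)
    filter_upwards [f.eventually_mem_dom unitI_mem hr'] with w hw
    exact hcon w hw
  obtain ⟨h, hh⟩ := f.exists_starInv hΩ hf'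
  have hc : ∀ {W : ℍ[ℂ]}, Quaternion.normSq W ≠ 0 →
      (((Quaternion.normSq W)⁻¹ : ℂ) : ℍ[ℂ]) * (Quaternion.normSq W : ℂ) = 1 := fun hW => by
    rw [← Quaternion.coe_mul, inv_mul_cancel₀ hW, Quaternion.coe_one]
  refine ⟨h, Germ.coe_eq.mpr ?_, Germ.coe_eq.mpr ?_⟩
  · filter_upwards [hh r hr', f.eventually_normSq_ne_zero hΩ.2 hf' hr'] with w h1 h2
    simp only [h1]
    -- The scalar `(normSq W)⁻¹` is central, so it can be moved in front of `W * star W`.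
    rw [← mul_assoc, ← Quaternion.coe_commutes, mul_assoc, Quaternion.self_mul_star, hc h2]
  · filter_upwards [hh r hr', f.eventually_normSq_ne_zero hΩ.2 hf' hr'] with w h1 h2
    simp only [h1]
    rw [mul_assoc, Quaternion.star_mul_self, hc h2]

/-- The ring of germs of stems of semiregular functions. -/
noncomputable def stemRing (hΩ : IsSymmSliceDomain Ω) (hr : (r : ℍ[ℝ]) ∈ Ω) :
    Subring ((𝓝[≠] (r : ℂ)).Germ ℍ[ℂ]) where
  carrier := Set.range (stemGerm (Ω := Ω) r)
  mul_mem' := by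
    rintro _ _ ⟨f, rfl⟩ ⟨g, rfl⟩
    obtain ⟨h, hd, hh⟩ := f.exists_starMul hΩ g
    exact ⟨h, (stemGerm_mul hr hd hh).symm⟩
  add_mem' := by
    rintro _ _ ⟨f, rfl⟩ ⟨g, rfl⟩
    obtain ⟨h, hd, hh⟩ := f.exists_add hΩ g
    exact ⟨h, (stemGerm_add hr hd hh).symm⟩
  one_mem' := by
    obtain ⟨h, hh⟩ := exists_stemGerm_const hΩ hr 1
    refine ⟨h, hh.trans (congrArg _ (funext fun _ => ?_))⟩
    exact stem_ext (by ext <;> simp) (by ext <;> simp)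
  zero_mem' := by
    obtain ⟨h, hh⟩ := exists_stemGerm_const hΩ hr 0
    refine ⟨h, hh.trans (congrArg _ (funext fun _ => ?_))⟩
    exact stem_ext (by ext <;> simp) (by ext <;> simp)
  neg_mem' := by
    rintro _ ⟨f, rfl⟩
    -- The negative is obtained as the product with the constant `-1`, reusing closure under
    -- multiplication.
    obtain ⟨k, hk⟩ := exists_stemGerm_const hΩ hr (-1)
    obtain ⟨h, hd, hh⟩ := k.exists_starMul hΩ f
    refine ⟨h, ?_⟩
    rw [← stemGerm_mul hr hd hh, hk, ← neg_one_mul]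
    refine congrArg _ (funext fun _ => ?_)
    exact stem_ext (by ext <;> simp) (by ext <;> simp)

/-- A semiregular function is determined by the germ of its stem. -/
noncomputable def semiregularEquiv (hΩ : IsSymmSliceDomain Ω) (hr : (r : ℍ[ℝ]) ∈ Ω) :
    Semiregular Ω ≃ stemRing hΩ hr :=
  Equiv.ofBijective
    (Quotient.lift (fun f => (⟨stemGerm r f, f, rfl⟩ : stemRing hΩ hr)) fun f g h =>
      Subtype.ext ((stemGerm_eq_iff hΩ hr f g).mpr h))
    ⟨by
      rintro ⟨f⟩ ⟨g⟩ h
      exact Quotient.sound ((stemGerm_eq_iff hΩ hr f g).mp (congrArg Subtype.val h)), by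
      rintro ⟨_, f, rfl⟩
      exact ⟨Quotient.mk _ f, rfl⟩⟩

/-- Nonzero germs of stems are invertible. -/
noncomputable abbrev stemRingDivisionRing (hΩ : IsSymmSliceDomain Ω) (hr : (r : ℍ[ℝ]) ∈ Ω) :
    DivisionRing (stemRing hΩ hr) :=
  haveI : Nontrivial ((𝓝[≠] (r : ℂ)).Germ ℍ[ℂ]) := inferInstance
  DivisionRing.ofIsUnitOrEqZero fun a => by
    by_cases ha : a = 0
    · exact Or.inr ha
    · left
      obtain ⟨_, f, rfl⟩ := a
      obtain ⟨h, h1, h2⟩ := exists_stemGerm_inv hΩ hr f fun h0 => ha (Subtype.ext h0)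
      exact ⟨⟨_, ⟨stemGerm r h, h, rfl⟩, Subtype.ext h1, Subtype.ext h2⟩, rfl⟩

end DivisionRing

end SliceReg

/-- The semiregular functions on a symmetric slice domain form a division ring with respect to
`+` and the regular product; sum and product of `f`, `g` are the pointwise sum and the regular
product (computed with any orthogonal imaginary units `I`, `J`) on the common domain. -/
theorem mainTheorem7 (Ω : Set (Quaternion ℝ)) (hΩ : SliceReg.IsSymmSliceDomain Ω) :
    ∃ _inst : DivisionRing (SliceReg.Semiregular Ω),
      (∀ f g : SliceReg.SemiregularFun Ω, ∃ h : SliceReg.SemiregularFun Ω,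
        h.dom = f.dom ∩ g.dom ∧
        (∀ q ∈ h.dom, h.toFun q = f.toFun q + g.toFun q) ∧
        SliceReg.Semiregular.mk f + SliceReg.Semiregular.mk g = SliceReg.Semiregular.mk h) ∧
      (∀ f g : SliceReg.SemiregularFun Ω, ∃ h : SliceReg.SemiregularFun Ω,
        h.dom = f.dom ∩ g.dom ∧
        (∀ I ∈ SliceReg.imagUnits, ∀ J ∈ SliceReg.imagUnits, inner ℝ I J = 0 →
          ∀ q ∈ h.dom, h.toFun q = SliceReg.starMul I J f.toFun g.toFun q) ∧
        SliceReg.Semiregular.mk f * SliceReg.Semiregular.mk g = SliceReg.Semiregular.mk h) := by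
  obtain ⟨r, hr⟩ := hΩ.1.2.2.1
  let _ := SliceReg.stemRingDivisionRing hΩ hr
  let e := SliceReg.semiregularEquiv hΩ hr
  refine ⟨e.divisionRing, fun f g => ?_, fun f g => ?_⟩
  · obtain ⟨h, hd, hh⟩ := f.exists_add hΩ g
    refine ⟨h, hd, fun q _ => congrFun hh q, e.injective (Subtype.ext ?_)⟩
    refine Eq.trans ?_ (SliceReg.stemGerm_add hr hd hh)
    change (e (e.symm (e (SliceReg.Semiregular.mk f) + e (SliceReg.Semiregular.mk g)))).1 = _
    rw [Equiv.apply_symm_apply]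
    rfl
  · obtain ⟨h, hd, hh⟩ := f.exists_starMul hΩ g
    refine ⟨h, hd, fun I hI J hJ hIJ q hq => ?_, e.injective (Subtype.ext ?_)⟩
    · obtain ⟨K, hK, w, rfl⟩ := SliceReg.exists_slicePt q
      rw [hd] at hq
      have hw := ((f.isAxiallySymmetric_inter g).slicePt_mem_iff SliceReg.unitI_mem hK).mp hq
      have hf := f.hasStem hw.1
      have hg := g.hasStem hw.2
      -- Both regular products have the product of the two stems as their stem, whichever orthogonal
      -- units compute them.
      rw [hh, hf.starMul SliceReg.unitI_mem SliceReg.unitJ_mem SliceReg.unitJ_mul_unitI hg K hK,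
        hf.starMul hI hJ (SliceReg.anticommute_of_inner_eq_zero hI hJ hIJ) hg K hK]
    · refine Eq.trans ?_ (SliceReg.stemGerm_mul hr hd hh)
      change (e (e.symm (e (SliceReg.Semiregular.mk f) * e (SliceReg.Semiregular.mk g)))).1 = _
      rw [Equiv.apply_symm_apply]
      rfl
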